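/- Let $B\subset\mathbb R^3$ be a bounded open set with boundary $\Gamma=\partial B$ and unit outward normal $\boldsymbol n$, let $\alpha>0$, $0<\mu_r<\infty$, $\omega,\sigma_*\in\mathbb R$, $\mu_0=4\pi\times10^{-7}$ and $\nu=\alpha^2\omega\mu_0\sigma_*$. Put $B^c=\mathbb R^3\setminus B$, $\tilde\mu_r=\mu_r$ in $B$ and $\tilde\mu_r=1$ in $B^c$, let $[\cdot]_\Gamma$ denote the jump across $\Gamma$, and let $\boldsymbol e_1,\boldsymbol e_2,\boldsymbol e_3$ be the standard basis. For $i=1,2,3$ let $\boldsymbol\theta_i^{(0)}$ (real-valued) and $\boldsymbol\theta_i^{(1)}$ (complex-valued) be weak solutions, of class $\boldsymbol H_{\rm loc}(\mathrm{curl})$ on $\mathbb R^3$, of the transmission problems $$\nabla\times\tilde\mu_r^{-1}\nabla\times\boldsymbol\theta_i^{(0)}=\boldsymbol 0,\quad \nabla\cdot\boldsymbol\theta_i^{(0)}=0\ \text{ in } B\cup B^c \text{ (off } \Gamma),\qquad [\boldsymbol n\times\boldsymbol\theta_i^{(0)}]_\Gamma=[\boldsymbol n\times\tilde\mu_r^{-1}\nabla\times\boldsymbol\theta_i^{(0)}]_\Gamma=\boldsymbol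 0,\qquad \boldsymbol\theta_i^{(0)}-\boldsymbol e_i\times\boldsymbol\xi=\boldsymbol O(|\boldsymbol\xi|^{-1})\ \ (|\boldsymbol\xi|\to\infty),$$ $$\nabla\times\mu_r^{-1}\nabla\times\boldsymbol\theta_i^{(1)}-\mathrm i\nu(\boldsymbol\theta_i^{(0)}+\boldsymbol\theta_i^{(1)})=\boldsymbol 0\ \text{ in } B,\qquad \nabla\times\nabla\times\boldsymbol\theta_i^{(1)}=\boldsymbol 0,\quad \nabla\cdot\boldsymbol\theta_i^{(1)}=0\ \text{ in } B^c \text{ (off } \Gamma),$$ $$[\boldsymbol n\times\boldsymbol\theta_i^{(1)}]_\Gamma=[\boldsymbol n\times\tilde\mu_r^{-1}\nabla\times\boldsymbol\theta_i^{(1)}]_\Gamma=\boldsymbol 0,\qquad \boldsymbol\theta_i^{(1)}=\boldsymbol O(|\boldsymbol\xi|^{-1})\ \ (|\boldsymbol\xi|\to\infty).$$ Here the curl-curl equations together with the jump conditions are understood variationally: for all compactly supported $\boldsymbol\psi\in\boldsymbol H(\mathrm{curl})$ (real-valued in the first identity, complex-valued in the second), $$\int_{\mathbb R^3}\tilde\mu_r^{-1}\,\nabla\times\boldsymbol\theta_i^{(0)}\cdot\nabla\times\boldsymbol\psi\,d\boldsymbol\xi=0,\qquad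 \int_{\mathbb R^3}\tilde\mu_r^{-1}\,\nabla\times\boldsymbol\theta_i^{(1)}\cdot\nabla\times\overline{\boldsymbol\psi}\,d\boldsymbol\xi-\mathrm i\nu\int_B(\boldsymbol\theta_i^{(0)}+\boldsymbol\theta_i^{(1)})\cdot\overline{\boldsymbol\psi}\,d\boldsymbol\xi=0,$$ and the divergence conditions are understood in the sense of distributions. With $\tilde{\boldsymbol\theta}_i^{(0)}=\boldsymbol\theta_i^{(0)}-\boldsymbol e_i\times\boldsymbol\xi$, a magnetic polarizability tensor (MPT) $\mathcal M[\alpha B,\omega,\mu_r,\sigma_*]=\mathcal N^0+\mathcal R+\mathrm i\,\mathcal I$ of the object $\alpha B$ is the tensor with coefficients computed from such solutions by $$(\mathcal N^0)_{ij}=\alpha^3\delta_{ij}\int_B(1-\mu_r^{-1})\,d\boldsymbol\xi+\frac{\alpha^3}{4}\int_{\mathbb R^3}\tilde\mu_r^{-1}\,\nabla\times\tilde{\boldsymbol\theta}_i^{(0)}\cdot\nabla\times\tilde{\boldsymbol\theta}_j^{(0)}\,d\boldsymbol\xi,\qquad (\mathcal R)_{ij}=-\frac{\alpha^3}{4}\int_{\mathbb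 R^3}\tilde\mu_r^{-1}\,\nabla\times\boldsymbol\theta_j^{(1)}\cdot\nabla\times\overline{\boldsymbol\theta_i^{(1)}}\,d\boldsymbol\xi,$$ $$(\mathcal I)_{ij}=\frac{\alpha^3}{4}\int_B\nu\,\bigl(\boldsymbol\theta_j^{(1)}+\tilde{\boldsymbol\theta}_j^{(0)}+\boldsymbol e_j\times\boldsymbol\xi\bigr)\cdot\overline{\bigl(\boldsymbol\theta_i^{(1)}+\tilde{\boldsymbol\theta}_i^{(0)}+\boldsymbol e_i\times\boldsymbol\xi\bigr)}\,d\boldsymbol\xi .$$ Let $s>0$. Then $$(\mathcal M[s\alpha B,\omega,\mu_r,\sigma_*])_{ij}=s^3\,(\mathcal M[\alpha B,s^2\omega,\mu_r,\sigma_*])_{ij}\qquad(i,j=1,2,3).$$ This holds however the object $s\alpha B$ is presented as $\alpha' B'$ with a size $\alpha'>0$ and a shape $B'$ (for example $\alpha'=s\alpha$, $B'=B$, or $\alpha'=\alpha$, $B'=sB$), and for every choice of solutions of the transmission problems on the two sides. Moreover a tensor $\mathcal M$ is an MPT of $\alpha B$ at frequency $s^2\omega$ if and only if $s^3\mathcal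 M$ is an MPT of $\alpha'B'$ at frequency $\omega$. -/

import Mathlib

open MeasureTheory
open scoped Pointwise

noncomputable section

namespace MPT

/-- Three-dimensional Euclidean space, over `ℝ` (points, real vectors) or `ℂ` (complex vectors). -/
abbrev V3 (𝕜 : Type*) := EuclideanSpace 𝕜 (Fin 3)

/-- The unit vector `e_i`. -/
def e (i : Fin 3) : V3 ℝ := EuclideanSpace.single i 1

/-- The vector field `ξ ↦ e_i × ξ`. -/
def eCross (i : Fin 3) (ξ : V3 ℝ) : V3 ℝ :=
  WithLp.toLp 2 (crossProduct (WithLp.ofLp (e i)) (WithLp.ofLp ξ))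

/-- A real vector regarded as a complex one. -/
def toC (v : V3 ℝ) : V3 ℂ := WithLp.toLp 2 fun k => (v k : ℂ)

/-! ### Curl and divergence in the weak sense -/

/-- The classical curl: `(∇ × φ)_k = ∂_{k+1} φ_{k+2} - ∂_{k+2} φ_{k+1}`, indices modulo `3`. -/
def curl (φ : V3 ℝ → V3 ℝ) (x : V3 ℝ) : V3 ℝ :=
  WithLp.toLp 2 fun k : Fin 3 =>
    fderiv ℝ φ x (e (k + 1)) (k + 2) - fderiv ℝ φ x (e (k + 2)) (k + 1)

/-- Locally square integrable vector fields on `ℝ³`. -/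
def MemL2Loc {𝕜 : Type*} [RCLike 𝕜] (u : V3 ℝ → V3 𝕜) : Prop :=
  ∀ K : Set (V3 ℝ), IsCompact K → MemLp u 2 (volume.restrict K)

/-- `v` is a weak curl of `u` on `ℝ³`: `∫ u · (∇ × φ) = ∫ v · φ` for all smooth compactly supported
vector fields `φ`. -/
def IsWeakCurl {𝕜 : Type*} [RCLike 𝕜] (u v : V3 ℝ → V3 𝕜) : Prop :=
  ∀ φ : V3 ℝ → V3 ℝ, ContDiff ℝ (⊤ : ℕ∞) φ → HasCompactSupport φ →
    ∫ x, ∑ k, (curl φ x k) • (u x k) = ∫ x, ∑ k, (φ x k) • (v x k)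

/-- The space `H_loc(curl)` on `ℝ³`. A field which is of this class on either side of a surface `Γ`
belongs to it exactly when its tangential trace `n × u` does not jump across `Γ`. -/
def MemHCurlLoc {𝕜 : Type*} [RCLike 𝕜] (u : V3 ℝ → V3 𝕜) : Prop :=
  MemL2Loc u ∧ ∃ v : V3 ℝ → V3 𝕜, MemL2Loc v ∧ IsWeakCurl u v

open Classical in
/-- The weak curl of a field of class `H_loc(curl)`; it is unique up to null sets. -/
def weakCurl {𝕜 : Type*} [RCLike 𝕜] (u : V3 ℝ → V3 𝕜) : V3 ℝ → V3 𝕜 :=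
  if h : ∃ v : V3 ℝ → V3 𝕜, MemL2Loc v ∧ IsWeakCurl u v then h.choose else 0

/-- `∇ · u = 0` in the open set `U`, in the sense of distributions. -/
def IsDivFreeOn {𝕜 : Type*} [RCLike 𝕜] (u : V3 ℝ → V3 𝕜) (U : Set (V3 ℝ)) : Prop :=
  ∀ φ : V3 ℝ → ℝ, ContDiff ℝ (⊤ : ℕ∞) φ → HasCompactSupport φ → tsupport φ ⊆ U →
    ∫ x, ∑ k, (fderiv ℝ φ x (e k)) • (u x k) = 0

/-- `u(ξ) = O(|ξ|⁻¹)` as `|ξ| → ∞`. -/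
def DecaysAtInfinity {𝕜 : Type*} [RCLike 𝕜] (u : V3 ℝ → V3 𝕜) : Prop :=
  ∃ C R : ℝ, ∀ᵐ ξ : V3 ℝ, R ≤ ‖ξ‖ → ‖u ξ‖ ≤ C * ‖ξ‖⁻¹

/-! ### The transmission problems -/

/-- The vacuum permeability. -/
def mu0 : ℝ := 4 * Real.pi * (10 : ℝ) ^ (-7 : ℤ)

/-- `ν = α² ω μ₀ σ_*`. -/
def nu (α ω σ : ℝ) : ℝ := α ^ 2 * ω * mu0 * σ

open Classical in
/-- The relative permeability: `μ_r` in `B` and `1` outside `B`. -/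
def muTilde (B : Set (V3 ℝ)) (μr : ℝ) (ξ : V3 ℝ) : ℝ := if ξ ∈ B then μr else 1

/-- `θ` is a weak solution `θ_i^{(0)}` of
`∇ × μ̃_r⁻¹ ∇ × θ = 0` and `∇ · θ = 0` in `B ∪ Bᶜ`,
`[n × θ] = 0` and `[n × μ̃_r⁻¹ ∇ × θ] = 0` on `∂B`, `θ - e_i × ξ = O(|ξ|⁻¹)`.
The jump condition on `n × θ` is `θ ∈ H_loc(curl)`; the curl-curl equation off `∂B` together with
the jump condition on `n × μ̃_r⁻¹ ∇ × θ` is the variational equation, tested with all compactly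
supported fields `ψ` of class `H(curl)`. -/
structure IsTheta0 (B : Set (V3 ℝ)) (μr : ℝ) (i : Fin 3) (θ : V3 ℝ → V3 ℝ) : Prop where
  memHCurlLoc : MemHCurlLoc θ
  weak_eq : ∀ ψ : V3 ℝ → V3 ℝ, MemHCurlLoc ψ → HasCompactSupport ψ →
    ∫ ξ, (muTilde B μr ξ)⁻¹ * inner ℝ (weakCurl ψ ξ) (weakCurl θ ξ) = 0
  div_free : IsDivFreeOn θ (frontier B)ᶜ
  decay : DecaysAtInfinity fun ξ => θ ξ - eCross i ξ

/-- `θ` is a weak solution `θ_i^{(1)}` (for the given `θ_i^{(0)} = θ0`) of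
`∇ × μ_r⁻¹ ∇ × θ - i ν (θ0 + θ) = 0` in `B`, `∇ × ∇ × θ = 0` and `∇ · θ = 0` in `Bᶜ`,
`[n × θ] = 0` and `[n × μ̃_r⁻¹ ∇ × θ] = 0` on `∂B`, `θ = O(|ξ|⁻¹)`. -/
structure IsTheta1 (B : Set (V3 ℝ)) (μr ν : ℝ) (θ0 : V3 ℝ → V3 ℝ) (θ : V3 ℝ → V3 ℂ) : Prop where
  memHCurlLoc : MemHCurlLoc θ
  weak_eq : ∀ ψ : V3 ℝ → V3 ℂ, MemHCurlLoc ψ → HasCompactSupport ψ →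
    (∫ ξ, (((muTilde B μr ξ)⁻¹ : ℝ) : ℂ) * inner ℂ (weakCurl ψ ξ) (weakCurl θ ξ)) -
      Complex.I * (ν : ℂ) * ∫ ξ in B, inner ℂ (ψ ξ) (toC (θ0 ξ) + θ ξ) = 0
  div_free : IsDivFreeOn θ (closure B)ᶜ
  decay : DecaysAtInfinity θ

/-! ### The magnetic polarizability tensor -/

/-- `θ̃_i^{(0)} = θ_i^{(0)} - e_i × ξ`. -/
def thetaTilde (θ0 : Fin 3 → V3 ℝ → V3 ℝ) (i : Fin 3) (ξ : V3 ℝ) : V3 ℝ := θ0 i ξ - eCross i ξ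

/-- The coefficients of `𝓝⁰[αB]`. -/
def tensorN0 (α : ℝ) (B : Set (V3 ℝ)) (μr : ℝ) (θ0 : Fin 3 → V3 ℝ → V3 ℝ) (i j : Fin 3) : ℝ :=
  α ^ 3 * (if i = j then 1 else 0) * (∫ _ξ in B, (1 - μr⁻¹)) +
    α ^ 3 / 4 * ∫ ξ, (muTilde B μr ξ)⁻¹ *
      inner ℝ (weakCurl (thetaTilde θ0 i) ξ) (weakCurl (thetaTilde θ0 j) ξ)

/-- The coefficients of `𝓡[αB, ω]`; `inner ℂ a b` is `b · conj a`. -/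
def tensorR (α : ℝ) (B : Set (V3 ℝ)) (μr : ℝ) (θ1 : Fin 3 → V3 ℝ → V3 ℂ) (i j : Fin 3) : ℂ :=
  -((α : ℂ) ^ 3 / 4) * ∫ ξ, (((muTilde B μr ξ)⁻¹ : ℝ) : ℂ) *
    inner ℂ (weakCurl (θ1 i) ξ) (weakCurl (θ1 j) ξ)

/-- The coefficients of `𝓘[αB, ω]`. -/
def tensorI (α : ℝ) (B : Set (V3 ℝ)) (ν : ℝ) (θ0 : Fin 3 → V3 ℝ → V3 ℝ)
    (θ1 : Fin 3 → V3 ℝ → V3 ℂ) (i j : Fin 3) : ℂ :=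
  (α : ℂ) ^ 3 / 4 * ∫ ξ in B, (ν : ℂ) *
    inner ℂ (θ1 i ξ + toC (thetaTilde θ0 i ξ + eCross i ξ))
      (θ1 j ξ + toC (thetaTilde θ0 j ξ + eCross j ξ))

/-- `M` is the magnetic polarizability tensor `𝓜[αB, ω, μ_r, σ_*] = 𝓝⁰ + 𝓡 + i 𝓘`, computed from
solutions of the transmission problems for `B`. -/
def IsMPT (α : ℝ) (B : Set (V3 ℝ)) (ω μr σ : ℝ) (M : Matrix (Fin 3) (Fin 3) ℂ) : Prop :=
  ∃ (θ0 : Fin 3 → V3 ℝ → V3 ℝ) (θ1 : Fin 3 → V3 ℝ → V3 ℂ),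
    (∀ i, IsTheta0 B μr i (θ0 i)) ∧
    (∀ i, IsTheta1 B μr (nu α ω σ) (θ0 i) (θ1 i)) ∧
    ∀ i j, M i j = (tensorN0 α B μr θ0 i j : ℂ) + tensorR α B μr θ1 i j +
      Complex.I * tensorI α B (nu α ω σ) θ0 θ1 i j

end MPT

end

/-!
The tensor depends on `α` and `B` only through the object `α B`: the dilation `u ↦ t u(· / t)` fixes
`e_i × ξ`, and it turns the solutions for `B` with parameter `ν t²` into solutions for `t B` with
parameter `ν`. For a fixed shape, passing from `α` to `s α` multiplies the coefficients of the
tensor by `s³`, and `ν` takes the same value for `s α` at frequency `ω` as for `α` at frequency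
`s² ω`.

For the independence of the solutions, the difference `W` of two total fields solves
`∇ × μ̃_r⁻¹ ∇ × W = i ν χ_B W` with `W = O(|ξ|⁻¹)`. Testing with `χ² W` for a cutoff `χ` of radius
`R`, the real part gives a Caccioppoli inequality whose right-hand side is `O(R⁻¹)`, so that
`∇ × W = 0`. What remains of the equation is `ν ∫_B χ |W|² = 0`, hence `W = 0` on `B` if `ν ≠ 0`.
-/

noncomputable section

namespace MPT

variable {𝕜 : Type*} [RCLike 𝕜]

/-! ### Locally square integrable fields -/

section MemL2Loc

variable {u v : V3 ℝ → V3 𝕜}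

theorem MemL2Loc.locallyIntegrable (hu : MemL2Loc u) : LocallyIntegrable u volume := by
  refine locallyIntegrable_iff.2 fun K hK => ?_
  have : IsFiniteMeasure (volume.restrict K) := ⟨by simpa using hK.measure_lt_top⟩
  exact (hu K hK).integrable one_le_two

theorem MemL2Loc.aestronglyMeasurable (hu : MemL2Loc u) : AEStronglyMeasurable u volume :=
  hu.locallyIntegrable.aestronglyMeasurable

theorem MemL2Loc.locallyIntegrable_apply (hu : MemL2Loc u) (k : Fin 3) :
    LocallyIntegrable (fun x => u x k) volume := by
  refine locallyIntegrable_iff.2 fun K hK => ?_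
  have h := locallyIntegrable_iff.1 hu.locallyIntegrable K hK
  exact (EuclideanSpace.proj (𝕜 := 𝕜) k).integrable_comp h

theorem MemL2Loc.locallyIntegrable_norm_sq (hu : MemL2Loc u) :
    LocallyIntegrable (fun x => ‖u x‖ ^ 2) volume :=
  locallyIntegrable_iff.2 fun K hK => (hu K hK).integrable_norm_pow two_ne_zero

theorem MemL2Loc.integrable_mul_norm_sq (hu : MemL2Loc u) {f : V3 ℝ → ℝ} (hf : Continuous f)
    (hfc : HasCompactSupport f) : Integrable (fun x => f x * ‖u x‖ ^ 2) volume :=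
  hu.locallyIntegrable_norm_sq.integrable_smul_left_of_hasCompactSupport hf hfc

theorem MemL2Loc.add (hu : MemL2Loc u) (hv : MemL2Loc v) : MemL2Loc (u + v) :=
  fun K hK => (hu K hK).add (hv K hK)

theorem MemL2Loc.sub (hu : MemL2Loc u) (hv : MemL2Loc v) : MemL2Loc (u - v) :=
  fun K hK => (hu K hK).sub (hv K hK)

theorem MemL2Loc.of_norm_le_mul (hu : MemL2Loc u) (hv : AEStronglyMeasurable v volume)
    {f : V3 ℝ → ℝ} (hf : Continuous f) (h : ∀ x, ‖v x‖ ≤ f x * ‖u x‖) : MemL2Loc v := by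
  intro K hK
  obtain ⟨C, hC⟩ := hK.exists_bound_of_continuousOn hf.continuousOn
  refine (hu K hK).of_le_mul (c := C) hv.restrict
    (ae_restrict_of_forall_mem hK.measurableSet fun x hx => (h x).trans ?_)
  gcongr
  exact (le_abs_self _).trans (hC x hx)

theorem MemL2Loc.of_continuous (hu : Continuous u) : MemL2Loc u := by
  intro K hK
  have : IsFiniteMeasure (volume.restrict K) := ⟨by simpa using hK.measure_lt_top⟩
  obtain ⟨C, hC⟩ := hK.exists_bound_of_continuousOn hu.continuousOn
  exact MemLp.of_bound hu.aestronglyMeasurable C (ae_restrict_of_forall_mem hK.measurableSet hC)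

theorem MemL2Loc.smul (hu : MemL2Loc u) {f : V3 ℝ → ℝ} (hf : Continuous f) :
    MemL2Loc fun x => f x • u x :=
  hu.of_norm_le_mul (hf.aestronglyMeasurable.smul hu.aestronglyMeasurable) hf.norm
    fun _ => (norm_smul _ _).le

theorem MemL2Loc.integrable_inner (hu : MemL2Loc u) (hv : MemL2Loc v) {K : Set (V3 ℝ)}
    (hK : IsCompact K) (huK : ∀ᵐ x, x ∉ K → u x = 0) :
    Integrable (fun x => inner 𝕜 (u x) (v x)) volume := by
  have hint : IntegrableOn (fun x => ‖u x‖ * ‖v x‖) K :=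
    (hu K hK).norm.integrable_mul (hv K hK).norm
  have hon : IntegrableOn (fun x => inner 𝕜 (u x) (v x)) K :=
    hint.mono' (hu.aestronglyMeasurable.inner hv.aestronglyMeasurable).restrict
      (.of_forall fun x => norm_inner_le_norm _ _)
  refine hon.integrable_of_ae_notMem_eq_zero ?_
  filter_upwards [huK] with x hx hxK
  rw [hx hxK, inner_zero_left]

theorem MemL2Loc.integrable_sum_smul (hu : MemL2Loc u) {φ : V3 ℝ → V3 ℝ} (hφ : Continuous φ)
    (hc : HasCompactSupport φ) : Integrable (fun x => ∑ k, φ x k • u x k) volume :=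
  integrable_finsetSum _ fun k _ =>
    (hu.locallyIntegrable_apply k).integrable_smul_left_of_hasCompactSupport (by fun_prop)
      (hc.comp_left (g := fun w : V3 ℝ => w k) rfl)

theorem MemL2Loc.integral_sum_smul_sub (hu : MemL2Loc u) (hv : MemL2Loc v) {φ : V3 ℝ → V3 ℝ}
    (hφ : Continuous φ) (hc : HasCompactSupport φ) :
    ∫ x, ∑ k, φ x k • (u - v) x k =
      (∫ x, ∑ k, φ x k • u x k) - ∫ x, ∑ k, φ x k • v x k := by
  rw [← integral_sub (hu.integrable_sum_smul hφ hc) (hv.integrable_sum_smul hφ hc)]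
  simp only [Pi.sub_apply, PiLp.sub_apply, smul_sub, Finset.sum_sub_distrib]

theorem MemL2Loc.ae_eq_zero_of_integral_sum_smul_eq_zero (hv : MemL2Loc v) {U : Set (V3 ℝ)}
    (hU : IsOpen U) (h : ∀ φ : V3 ℝ → V3 ℝ, ContDiff ℝ (⊤ : ℕ∞) φ → HasCompactSupport φ →
      tsupport φ ⊆ U → ∫ x, ∑ k, φ x k • v x k = 0) :
    ∀ᵐ x, x ∈ U → v x = 0 := by
  have component (k : Fin 3) : ∀ᵐ x, x ∈ U → v x k = 0 := by
    refine hU.ae_eq_zero_of_integral_contDiff_smul_eq_zero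
      ((hv.locallyIntegrable_apply k).locallyIntegrableOn U) fun g hg hgc hgU => ?_
    rw [← h (fun x => g x • e k) (hg.smul contDiff_const) hgc.smul_right
      ((tsupport_smul_subset_left _ _).trans hgU)]
    refine integral_congr_ae (.of_forall fun x => ?_)
    simp [e]
  filter_upwards [ae_all_iff.2 component] with x hx hxU
  ext k
  exact hx k hxU

end MemL2Loc

/-! ### The weak curl -/

theorem curl_eq_zero_of_notMem_tsupport {φ : V3 ℝ → V3 ℝ} {x : V3 ℝ} (hx : x ∉ tsupport φ) :
    curl φ x = 0 := by
  ext k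
  simp [curl, fderiv_of_notMem_tsupport (𝕜 := ℝ) hx]

theorem hasCompactSupport_curl {φ : V3 ℝ → V3 ℝ} (hφ : HasCompactSupport φ) :
    HasCompactSupport (curl φ) :=
  hφ.mono' fun _ hx => not_imp_comm.1 curl_eq_zero_of_notMem_tsupport hx

theorem continuous_curl {φ : V3 ℝ → V3 ℝ} (hφ : ContDiff ℝ 1 φ) : Continuous (curl φ) := by
  have : Continuous (fderiv ℝ φ) := hφ.continuous_fderiv one_ne_zero
  unfold curl
  fun_prop

section WeakCurl

variable {u v u' v' : V3 ℝ → V3 𝕜}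

theorem IsWeakCurl.sub (h : IsWeakCurl u v) (h' : IsWeakCurl u' v') (hu : MemL2Loc u)
    (hv : MemL2Loc v) (hu' : MemL2Loc u') (hv' : MemL2Loc v') :
    IsWeakCurl (u - u') (v - v') := by
  intro φ hφ hc
  rw [hu.integral_sum_smul_sub hu' (continuous_curl (hφ.of_le (by simp)))
      (hasCompactSupport_curl hc),
    hv.integral_sum_smul_sub hv' hφ.continuous hc, h φ hφ hc, h' φ hφ hc]

theorem IsWeakCurl.congr_right (h : IsWeakCurl u v) (hv : v =ᵐ[volume] v') : IsWeakCurl u v' := by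
  intro φ hφ hc
  rw [h φ hφ hc]
  refine integral_congr_ae ?_
  filter_upwards [hv] with x hx
  rw [hx]

theorem IsWeakCurl.ae_unique (h : IsWeakCurl u v) (h' : IsWeakCurl u v') (hv : MemL2Loc v)
    (hv' : MemL2Loc v') : v =ᵐ[volume] v' := by
  have hzero := (hv.sub hv').ae_eq_zero_of_integral_sum_smul_eq_zero isOpen_univ
    fun φ hφ hc _ => by
      rw [hv.integral_sum_smul_sub hv' hφ.continuous hc, ← h φ hφ hc, ← h' φ hφ hc, sub_self]
  filter_upwards [hzero] with x hx
  exact sub_eq_zero.1 (hx (Set.mem_univ x))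

theorem IsWeakCurl.ae_eq_zero_of_notMem_tsupport (h : IsWeakCurl u v) (hv : MemL2Loc v) :
    ∀ᵐ x, x ∉ tsupport u → v x = 0 := by
  refine hv.ae_eq_zero_of_integral_sum_smul_eq_zero (isClosed_tsupport u).isOpen_compl
    fun φ hφ hc hφu => ?_
  rw [← h φ hφ hc, ← integral_zero (V3 ℝ) 𝕜]
  congr 1
  ext x
  by_cases hx : x ∈ tsupport u
  · simp [curl_eq_zero_of_notMem_tsupport fun hxφ => hφu hxφ hx]
  · simp [image_eq_zero_of_notMem_tsupport hx]

theorem isWeakCurl_iff_of_sub (hu : MemL2Loc u) (hu' : MemL2Loc u') (h : IsWeakCurl (u - u') 0) :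
    IsWeakCurl u v ↔ IsWeakCurl u' v := by
  refine forall₃_congr fun φ hφ hc => ?_
  have hzero := h φ hφ hc
  rw [hu.integral_sum_smul_sub hu' (continuous_curl (hφ.of_le (by simp)))
    (hasCompactSupport_curl hc)] at hzero
  rw [sub_eq_zero.1 (hzero.trans (by simp))]

theorem weakCurl_eq_of_sub (hu : MemL2Loc u) (hu' : MemL2Loc u') (h : IsWeakCurl (u - u') 0) :
    weakCurl u = weakCurl u' := by
  have heq : IsWeakCurl u = IsWeakCurl u' :=
    funext fun _ => propext (isWeakCurl_iff_of_sub hu hu' h)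
  unfold weakCurl
  rw [heq]

theorem IsWeakCurl.weakCurl_ae_eq (h : IsWeakCurl u v) (hv : MemL2Loc v) :
    weakCurl u =ᵐ[volume] v := by
  have hex : ∃ v : V3 ℝ → V3 𝕜, MemL2Loc v ∧ IsWeakCurl u v := ⟨v, hv, h⟩
  rw [weakCurl, dif_pos hex]
  exact hex.choose_spec.2.ae_unique h hex.choose_spec.1 hv

theorem MemHCurlLoc.memL2Loc (hu : MemHCurlLoc u) : MemL2Loc u := hu.1

theorem MemHCurlLoc.memL2Loc_weakCurl (hu : MemHCurlLoc u) : MemL2Loc (weakCurl u) := by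
  rw [weakCurl, dif_pos hu.2]
  exact hu.2.choose_spec.1

theorem MemHCurlLoc.isWeakCurl (hu : MemHCurlLoc u) : IsWeakCurl u (weakCurl u) := by
  rw [weakCurl, dif_pos hu.2]
  exact hu.2.choose_spec.2

theorem MemHCurlLoc.of_sub (hu' : MemHCurlLoc u') (hu : MemL2Loc u) (h : IsWeakCurl (u - u') 0) :
    MemHCurlLoc u :=
  ⟨hu, _, hu'.memL2Loc_weakCurl, (isWeakCurl_iff_of_sub hu hu'.memL2Loc h).2 hu'.isWeakCurl⟩

theorem MemHCurlLoc.isWeakCurl_sub (hu : MemHCurlLoc u) (hu' : MemHCurlLoc u') :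
    IsWeakCurl (u - u') (weakCurl u - weakCurl u') :=
  hu.isWeakCurl.sub hu'.isWeakCurl hu.memL2Loc hu.memL2Loc_weakCurl hu'.memL2Loc
    hu'.memL2Loc_weakCurl

theorem MemHCurlLoc.sub (hu : MemHCurlLoc u) (hu' : MemHCurlLoc u') : MemHCurlLoc (u - u') :=
  ⟨hu.memL2Loc.sub hu'.memL2Loc, _, hu.memL2Loc_weakCurl.sub hu'.memL2Loc_weakCurl,
    hu.isWeakCurl_sub hu'⟩

theorem MemHCurlLoc.weakCurl_sub (hu : MemHCurlLoc u) (hu' : MemHCurlLoc u') :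
    weakCurl (u - u') =ᵐ[volume] weakCurl u - weakCurl u' :=
  (hu.isWeakCurl_sub hu').weakCurl_ae_eq (hu.memL2Loc_weakCurl.sub hu'.memL2Loc_weakCurl)

theorem weakCurl_eq_of_weakCurl_sub_ae_eq_zero (hu : MemHCurlLoc u) (hu' : MemHCurlLoc u')
    (h : weakCurl (u - u') =ᵐ[volume] 0) : weakCurl u = weakCurl u' :=
  weakCurl_eq_of_sub hu.memL2Loc hu'.memL2Loc ((hu.sub hu').isWeakCurl.congr_right h)

end WeakCurl

/-! ### Complexification -/

theorem continuous_toC : Continuous toC := by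
  unfold toC
  fun_prop

theorem norm_toC (v : V3 ℝ) : ‖toC v‖ = ‖v‖ := by
  simp [EuclideanSpace.norm_eq, toC]

theorem toC_zero : toC 0 = 0 := by
  ext
  simp [toC]

theorem toC_sub (v w : V3 ℝ) : toC (v - w) = toC v - toC w := by
  ext k
  simp [toC]

theorem toC_smul (t : ℝ) (v : V3 ℝ) : toC (t • v) = t • toC v := by
  ext k
  simp [toC]

theorem MemL2Loc.toC {u : V3 ℝ → V3 ℝ} (hu : MemL2Loc u) : MemL2Loc fun x => toC (u x) :=
  fun K hK => (hu K hK).of_le (continuous_toC.comp_aestronglyMeasurable (hu K hK).1)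
    (.of_forall fun _ => (norm_toC _).le)

theorem integral_sum_smul_toC (φ u : V3 ℝ → V3 ℝ) :
    ∫ x, ∑ k, φ x k • toC (u x) k = ((∫ x, ∑ k, φ x k • u x k : ℝ) : ℂ) := by
  rw [← integral_complex_ofReal]
  simp [toC]

theorem IsWeakCurl.toC {u v : V3 ℝ → V3 ℝ} (h : IsWeakCurl u v) :
    IsWeakCurl (fun x => toC (u x)) fun x => toC (v x) := by
  intro φ hφ hc
  rw [integral_sum_smul_toC, integral_sum_smul_toC, h φ hφ hc]

/-! ### The product rule -/

/-- The cross product `g × u` of a gradient `g`, given as a linear form, with a vector `u`: the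
first order term in the product rule for the curl. -/
def gradCross (g : V3 ℝ →L[ℝ] ℝ) (u : V3 𝕜) : V3 𝕜 :=
  WithLp.toLp 2 fun k : Fin 3 => g (e (k + 1)) • u (k + 2) - g (e (k + 2)) • u (k + 1)

theorem continuous_gradCross :
    Continuous fun p : (V3 ℝ →L[ℝ] ℝ) × V3 𝕜 => gradCross p.1 p.2 := by
  unfold gradCross
  fun_prop

theorem gradCross_smul (c : ℝ) (g : V3 ℝ →L[ℝ] ℝ) (u : V3 𝕜) :
    gradCross (c • g) u = c • gradCross g u := by
  ext k
  simp [gradCross, smul_sub, mul_smul]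

theorem gradCross_zero_right (g : V3 ℝ →L[ℝ] ℝ) : gradCross g (0 : V3 𝕜) = 0 := by
  ext k
  simp [gradCross]

theorem sum_smul_gradCross (g : V3 ℝ →L[ℝ] ℝ) (a : V3 ℝ) (u : V3 𝕜) :
    ∑ k, a k • gradCross g u k = -∑ k, gradCross g a k • u k := by
  have index : (1 : Fin 3) + 2 = 0 ∧ (2 : Fin 3) + 1 = 0 ∧ (2 : Fin 3) + 2 = 1 ∧
    (1 : Fin 3) + 1 = 2 := by decide
  simp only [Fin.sum_univ_three, gradCross, index, zero_add, RCLike.real_smul_eq_coe_mul,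
    RCLike.ofReal_sub, RCLike.ofReal_mul, RCLike.ofReal_real_eq_id, id_eq]
  ring

theorem norm_gradCross_le (g : V3 ℝ →L[ℝ] ℝ) (u : V3 𝕜) :
    ‖gradCross g u‖ ≤ 4 * (‖g‖ * ‖u‖) := by
  have term (i j : Fin 3) : ‖g (e i) • u j‖ ≤ ‖g‖ * ‖u‖ := by
    rw [norm_smul]
    gcongr
    · simpa [e] using g.le_opNorm (e i)
    · exact PiLp.norm_apply_le u j
  have component (k : Fin 3) : ‖gradCross g u k‖ ^ 2 ≤ (2 * (‖g‖ * ‖u‖)) ^ 2 := by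
    gcongr
    refine (norm_sub_le _ _).trans ?_
    linarith [term (k + 1) (k + 2), term (k + 2) (k + 1)]
  refine le_of_sq_le_sq ?_ (by positivity)
  rw [EuclideanSpace.norm_sq_eq, Fin.sum_univ_three]
  nlinarith [component 0, component 1, component 2, sq_nonneg (‖g‖ * ‖u‖)]

theorem curl_smul {χ : V3 ℝ → ℝ} {φ : V3 ℝ → V3 ℝ} {x : V3 ℝ} (hχ : DifferentiableAt ℝ χ x)
    (hφ : DifferentiableAt ℝ φ x) :
    curl (fun y => χ y • φ y) x = χ x • curl φ x + gradCross (fderiv ℝ χ x) (φ x) := by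
  ext k
  simp only [curl, gradCross, fderiv_fun_smul hχ hφ, add_apply, smul_apply,
    ContinuousLinearMap.smulRight_apply, PiLp.add_apply, PiLp.smul_apply, smul_eq_mul]
  ring

theorem sum_curl_smul_smul {χ : V3 ℝ → ℝ} {φ : V3 ℝ → V3 ℝ} {x : V3 ℝ}
    (hχ : DifferentiableAt ℝ χ x) (hφ : DifferentiableAt ℝ φ x) (u : V3 𝕜) :
    ∑ k, curl φ x k • (χ x • u) k = ∑ k, curl (fun y => χ y • φ y) x k • u k -
      ∑ k, gradCross (fderiv ℝ χ x) (φ x) k • u k := by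
  rw [curl_smul hχ hφ, ← Finset.sum_sub_distrib]
  refine Finset.sum_congr rfl fun k _ => ?_
  simp only [PiLp.add_apply, PiLp.smul_apply, smul_smul, add_smul, smul_eq_mul]
  rw [mul_comm, add_sub_cancel_right]

theorem sum_smul_smul_add_gradCross (c : ℝ) (g : V3 ℝ →L[ℝ] ℝ) (a : V3 ℝ) (u v : V3 𝕜) :
    ∑ k, a k • (c • v + gradCross g u) k =
      ∑ k, (c • a) k • v k - ∑ k, gradCross g a k • u k := by
  rw [sub_eq_add_neg, ← sum_smul_gradCross, ← Finset.sum_add_distrib]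
  refine Finset.sum_congr rfl fun k _ => ?_
  simp only [PiLp.add_apply, PiLp.smul_apply, smul_smul, smul_add, smul_eq_mul]
  rw [mul_comm]

section ProductRule

variable {u v : V3 ℝ → V3 𝕜} {χ : V3 ℝ → ℝ}

theorem MemL2Loc.smul_add_gradCross (hu : MemL2Loc u) (hv : MemL2Loc v) (hχ : ContDiff ℝ 1 χ) :
    MemL2Loc fun x => χ x • v x + gradCross (fderiv ℝ χ x) (u x) := by
  have h : Continuous (fderiv ℝ χ) := hχ.continuous_fderiv one_ne_zero
  refine (hv.smul hχ.continuous).add (hu.of_norm_le_mul (f := fun x => 4 * ‖fderiv ℝ χ x‖)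
    ?_ (by fun_prop) fun x => ?_)
  · exact continuous_gradCross.comp_aestronglyMeasurable
      (h.aestronglyMeasurable.prodMk hu.aestronglyMeasurable)
  · rw [mul_assoc]
    exact norm_gradCross_le _ _

theorem IsWeakCurl.smul (h : IsWeakCurl u v) (hu : MemL2Loc u) (hv : MemL2Loc v)
    (hχ : ContDiff ℝ (⊤ : ℕ∞) χ) :
    IsWeakCurl (fun x => χ x • u x) fun x => χ x • v x + gradCross (fderiv ℝ χ x) (u x) := by
  intro φ hφ hc
  have hχφ : ContDiff ℝ (⊤ : ℕ∞) fun x => χ x • φ x := hχ.smul hφ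
  have hχφc : HasCompactSupport fun x => χ x • φ x :=
    hc.mono (Function.support_smul_subset_right χ φ)
  have hcurl : Continuous (curl fun x => χ x • φ x) := continuous_curl (hχφ.of_le (by simp))
  have hcross : Continuous fun x => gradCross (fderiv ℝ χ x) (φ x) :=
    continuous_gradCross.comp ((hχ.continuous_fderiv (by simp)).prodMk hφ.continuous)
  have hcrossc : HasCompactSupport fun x => gradCross (fderiv ℝ χ x) (φ x) :=
    hc.mono fun x hx hφx => hx (by simp only [hφx, gradCross_zero_right])
  simp only [sum_curl_smul_smul (hχ.differentiable (by simp) _) (hφ.differentiable (by simp) _),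
    sum_smul_smul_add_gradCross]
  rw [integral_sub (hu.integrable_sum_smul hcurl (hasCompactSupport_curl hχφc))
      (hu.integrable_sum_smul hcross hcrossc),
    integral_sub (hv.integrable_sum_smul hχφ.continuous hχφc)
      (hu.integrable_sum_smul hcross hcrossc), h _ hχφ hχφc]

theorem MemHCurlLoc.isWeakCurl_smul (hu : MemHCurlLoc u) (hχ : ContDiff ℝ (⊤ : ℕ∞) χ) :
    IsWeakCurl (fun x => χ x • u x)
      fun x => χ x • weakCurl u x + gradCross (fderiv ℝ χ x) (u x) :=
  hu.isWeakCurl.smul hu.memL2Loc hu.memL2Loc_weakCurl hχ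

theorem MemHCurlLoc.smul (hu : MemHCurlLoc u) (hχ : ContDiff ℝ (⊤ : ℕ∞) χ) :
    MemHCurlLoc fun x => χ x • u x :=
  ⟨hu.memL2Loc.smul hχ.continuous, _,
    hu.memL2Loc.smul_add_gradCross hu.memL2Loc_weakCurl (hχ.of_le (by simp)),
    hu.isWeakCurl_smul hχ⟩

theorem MemHCurlLoc.weakCurl_smul (hu : MemHCurlLoc u) (hχ : ContDiff ℝ (⊤ : ℕ∞) χ) :
    weakCurl (fun x => χ x • u x) =ᵐ[volume]
      fun x => χ x • weakCurl u x + gradCross (fderiv ℝ χ x) (u x) :=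
  (hu.isWeakCurl_smul hχ).weakCurl_ae_eq
    (hu.memL2Loc.smul_add_gradCross hu.memL2Loc_weakCurl (hχ.of_le (by simp)))

end ProductRule

/-! ### The curl-curl form -/

/-- A measurable coefficient with values in `[c, C]`, where `c > 0`; the hypothesis on the
coefficient `m` of the operator `∇ × m ∇ ×`. -/
structure IsUniformlyElliptic (m : V3 ℝ → ℝ) (c C : ℝ) : Prop where
  measurable : Measurable m
  pos : 0 < c
  le_apply : ∀ x, c ≤ m x
  apply_le : ∀ x, m x ≤ C

/-- The sesquilinear form `∫ m (∇ × v) · conj (∇ × u)` of the operator `∇ × m ∇ ×`; like the inner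
product it is conjugate linear in the first argument. -/
def curlForm (m : V3 ℝ → ℝ) (u v : V3 ℝ → V3 𝕜) : 𝕜 :=
  ∫ x, m x • inner 𝕜 (weakCurl u x) (weakCurl v x)

section CurlForm

variable {m : V3 ℝ → ℝ} {c C : ℝ}

theorem isUniformlyElliptic_inv_muTilde {B : Set (V3 ℝ)} (hB : MeasurableSet B) {μr : ℝ}
    (hμ : 0 < μr) : IsUniformlyElliptic (muTilde B μr)⁻¹ (min μr⁻¹ 1) (max μr⁻¹ 1) where
  measurable := (Measurable.ite hB measurable_const measurable_const).inv
  pos := lt_min (inv_pos.2 hμ) one_pos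
  le_apply x := by
    rw [Pi.inv_apply, muTilde]
    split_ifs <;> simp
  apply_le x := by
    rw [Pi.inv_apply, muTilde]
    split_ifs <;> simp

theorem IsUniformlyElliptic.integrable_smul_inner_weakCurl (hm : IsUniformlyElliptic m c C)
    {ψ U : V3 ℝ → V3 𝕜} (hψ : MemHCurlLoc ψ) (hψc : HasCompactSupport ψ) (hU : MemL2Loc U) :
    Integrable (fun x => m x • inner 𝕜 (weakCurl ψ x) (U x)) volume := by
  refine (hψ.memL2Loc_weakCurl.integrable_inner hU hψc
    (hψ.isWeakCurl.ae_eq_zero_of_notMem_tsupport hψ.memL2Loc_weakCurl)).bdd_smul C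
    hm.measurable.aestronglyMeasurable (.of_forall fun x => ?_)
  rw [Real.norm_of_nonneg (hm.pos.le.trans (hm.le_apply x))]
  exact hm.apply_le x

theorem IsUniformlyElliptic.curlForm_sub_right (hm : IsUniformlyElliptic m c C)
    {ψ u v : V3 ℝ → V3 𝕜} (hψ : MemHCurlLoc ψ) (hψc : HasCompactSupport ψ) (hu : MemHCurlLoc u)
    (hv : MemHCurlLoc v) : curlForm m ψ (u - v) = curlForm m ψ u - curlForm m ψ v := by
  unfold curlForm
  rw [← integral_sub (hm.integrable_smul_inner_weakCurl hψ hψc hu.memL2Loc_weakCurl)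
    (hm.integrable_smul_inner_weakCurl hψ hψc hv.memL2Loc_weakCurl)]
  refine integral_congr_ae ?_
  filter_upwards [hu.weakCurl_sub hv] with x hx
  rw [hx, Pi.sub_apply, inner_sub_right, smul_sub]

theorem curlForm_eq_zero_of_weakCurl_ae_eq_zero {u v : V3 ℝ → V3 𝕜}
    (hv : weakCurl v =ᵐ[volume] 0) : curlForm m u v = 0 := by
  refine integral_eq_zero_of_ae ?_
  filter_upwards [hv] with x hx
  simp [hx]

/-! ### The Caccioppoli inequality -/

-- Young's inequality for the cross term: `2 |a| ‖w‖ ‖V‖ ≤ a² ‖V‖² / 2 + 2 ‖w‖²`.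
theorem sub_le_re_inner_sq_smul_add (a : ℝ) (V w : V3 𝕜) :
    1 / 2 * (a ^ 2 * ‖V‖ ^ 2) - 2 * ‖w‖ ^ 2 ≤
      RCLike.re (inner 𝕜 (a ^ 2 • V + (2 * a) • w) V) := by
  have diagonal : RCLike.re (inner 𝕜 (a ^ 2 • V) V) = a ^ 2 * ‖V‖ ^ 2 := by
    rw [RCLike.real_smul_eq_coe_smul (K := 𝕜), inner_smul_left, RCLike.conj_ofReal,
      RCLike.re_ofReal_mul, inner_self_eq_norm_sq]
  have cross : |RCLike.re (inner 𝕜 ((2 * a) • w) V)| ≤ 2 * |a| * ‖w‖ * ‖V‖ := by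
    refine (RCLike.abs_re_le_norm _).trans ((norm_inner_le_norm _ _).trans ?_)
    rw [norm_smul, Real.norm_eq_abs, abs_mul, abs_two]
  rw [inner_add_left, map_add, diagonal, ← sq_abs a]
  nlinarith [sq_nonneg (|a| * ‖V‖ - 2 * ‖w‖), neg_le_of_abs_le cross]

theorem sub_le_re_smul_inner_sq_smul_add_gradCross {k a : ℝ} (hc : 0 ≤ c) (hck : c ≤ k)
    (hkC : k ≤ C) (g : V3 ℝ →L[ℝ] ℝ) (V w : V3 𝕜) :
    c / 2 * (a ^ 2 * ‖V‖ ^ 2) - 32 * C * (‖g‖ ^ 2 * ‖w‖ ^ 2) ≤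
      RCLike.re (k • inner 𝕜 (a ^ 2 • V + gradCross ((2 * a) • g) w) V) := by
  have hcross := pow_le_pow_left₀ (norm_nonneg _) (norm_gradCross_le g w) 2
  have hyoung := sub_le_re_inner_sq_smul_add a V (gradCross g w)
  rw [gradCross_smul, RCLike.smul_re]
  calc c / 2 * (a ^ 2 * ‖V‖ ^ 2) - 32 * C * (‖g‖ ^ 2 * ‖w‖ ^ 2)
      ≤ k / 2 * (a ^ 2 * ‖V‖ ^ 2) - 32 * k * (‖g‖ ^ 2 * ‖w‖ ^ 2) := by gcongr
    _ = k * (1 / 2 * (a ^ 2 * ‖V‖ ^ 2) - 2 * (4 * (‖g‖ * ‖w‖)) ^ 2) := by ring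
    _ ≤ _ := mul_le_mul_of_nonneg_left (by linarith) (hc.trans hck)

theorem IsUniformlyElliptic.ae_sub_le_re_smul_inner_weakCurl_sq_smul
    (hm : IsUniformlyElliptic m c C) {W : V3 ℝ → V3 𝕜} (hW : MemHCurlLoc W) {χ : V3 ℝ → ℝ}
    (hχ : ContDiff ℝ (⊤ : ℕ∞) χ) : ∀ᵐ x,
      c / 2 * (χ x ^ 2 * ‖weakCurl W x‖ ^ 2) - 32 * C * (‖fderiv ℝ χ x‖ ^ 2 * ‖W x‖ ^ 2) ≤
        RCLike.re (m x • inner 𝕜 (weakCurl (fun y => χ y ^ 2 • W y) x) (weakCurl W x)) := by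
  filter_upwards [hW.weakCurl_smul (hχ.pow 2)] with x hx
  have hderiv : fderiv ℝ (fun y => χ y ^ 2) x = (2 * χ x) • fderiv ℝ χ x := by
    rw [fderiv_fun_pow 2 (hχ.differentiable (by simp) x)]
    simp
  rw [hx, hderiv]
  exact sub_le_re_smul_inner_sq_smul_add_gradCross hm.pos.le (hm.le_apply x) (hm.apply_le x) _ _ _

theorem IsUniformlyElliptic.caccioppoli (hm : IsUniformlyElliptic m c C) {W : V3 ℝ → V3 𝕜}
    (hW : MemHCurlLoc W) {χ : V3 ℝ → ℝ} (hχ : ContDiff ℝ (⊤ : ℕ∞) χ) (hχc : HasCompactSupport χ)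
    (h : RCLike.re (curlForm m (fun x => χ x ^ 2 • W x) W) = 0) :
    c * ∫ x, χ x ^ 2 * ‖weakCurl W x‖ ^ 2 ≤ 64 * C * ∫ x, ‖fderiv ℝ χ x‖ ^ 2 * ‖W x‖ ^ 2 := by
  have hη : ContDiff ℝ (⊤ : ℕ∞) fun x => χ x ^ 2 := hχ.pow 2
  have hηc : HasCompactSupport fun x => χ x ^ 2 := hχc.comp_left (g := (· ^ 2)) (by simp)
  have hηWc : HasCompactSupport fun x => χ x ^ 2 • W x := hηc.smul_right
  have hform := hm.integrable_smul_inner_weakCurl (hW.smul hη) hηWc hW.memL2Loc_weakCurl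
  have hcurl := hW.memL2Loc_weakCurl.integrable_mul_norm_sq hη.continuous hηc
  have hgradc : HasCompactSupport fun x => ‖fderiv ℝ χ x‖ ^ 2 :=
    (hχc.fderiv (𝕜 := ℝ)).comp_left (g := fun L => ‖L‖ ^ 2) (by simp)
  have hgrad := hW.memL2Loc.integrable_mul_norm_sq
    (f := fun x => ‖fderiv ℝ χ x‖ ^ 2) ((hχ.continuous_fderiv (by simp)).norm.pow 2) hgradc
  have hle := integral_mono_ae ((hcurl.const_mul (c / 2)).sub (hgrad.const_mul (32 * C))) hform.re
    (hm.ae_sub_le_re_smul_inner_weakCurl_sq_smul hW hχ)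
  rw [integral_re hform, ← curlForm, h, integral_sub' (hcurl.const_mul _) (hgrad.const_mul _),
    integral_const_mul, integral_const_mul] at hle
  linarith

end CurlForm

/-! ### Decay at infinity -/

theorem exists_cutoff (E : Type*) [NormedAddCommGroup E] [NormedSpace ℝ E]
    [FiniteDimensional ℝ E] : ∃ G : ℝ, ∀ R : ℝ, 0 < R → ∃ χ : E → ℝ, ContDiff ℝ (⊤ : ℕ∞) χ ∧
      HasCompactSupport χ ∧ (∀ x ∈ Metric.closedBall (0 : E) R, χ x = 1) ∧
      ∀ x, ‖fderiv ℝ χ x‖ ≤ (Metric.closedBall (0 : E) (2 * R) \ Metric.ball 0 R).indicator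
        (fun _ => G * R⁻¹) x := by
  let f : ContDiffBump (0 : E) := ⟨1, 2, one_pos, one_lt_two⟩
  have hf : ContDiff ℝ (⊤ : ℕ∞) f := f.contDiff
  obtain ⟨G, hG⟩ := (f.hasCompactSupport.fderiv (𝕜 := ℝ)).exists_bound_of_continuous
    (hf.continuous_fderiv (by simp))
  refine ⟨G, fun R hR => ⟨fun x => f (R⁻¹ • x), hf.comp (contDiff_const_smul _),
    f.hasCompactSupport.comp_smul (inv_ne_zero hR.ne'), fun x hx => ?_, fun x => ?_⟩⟩
  · refine f.one_of_mem_closedBall ?_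
    rw [mem_closedBall_zero_iff, norm_smul, norm_inv, Real.norm_of_nonneg hR.le]
    exact (inv_mul_le_one₀ hR).2 (mem_closedBall_zero_iff.1 hx)
  have hnorm : ‖R⁻¹ • x‖ = R⁻¹ * ‖x‖ := by
    rw [norm_smul, norm_inv, Real.norm_of_nonneg hR.le]
  rw [fderiv_comp_smul, norm_smul, norm_inv, Real.norm_of_nonneg hR.le]
  by_cases hx : x ∈ Metric.closedBall (0 : E) (2 * R) \ Metric.ball 0 R
  · rw [Set.indicator_of_mem hx, mul_comm]
    gcongr
    exact hG _
  suffices h : fderiv ℝ f (R⁻¹ • x) = 0 by simp [hx, h]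
  rw [Set.mem_sdiff, not_and_or, not_not, mem_closedBall_zero_iff, mem_ball_zero_iff] at hx
  obtain houter | hinner := hx
  · refine fderiv_of_notMem_tsupport (𝕜 := ℝ) fun hmem => houter ?_
    rw [f.tsupport_eq, mem_closedBall_zero_iff, hnorm, inv_mul_le_iff₀ hR, mul_comm] at hmem
    exact hmem
  · have hone : R⁻¹ • x ∈ Metric.ball (0 : E) f.rIn := by
      rw [mem_ball_zero_iff, hnorm]
      exact (inv_mul_lt_one₀ hR).2 hinner
    rw [(f.eventuallyEq_one_of_mem_ball hone).fderiv_eq, Pi.one_def, fderiv_fun_const]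
    rfl

section Decay

variable {u v W : V3 ℝ → V3 𝕜}

theorem DecaysAtInfinity.sub (hu : DecaysAtInfinity u) (hv : DecaysAtInfinity v) :
    DecaysAtInfinity (u - v) := by
  obtain ⟨C, R, h⟩ := hu
  obtain ⟨C', R', h'⟩ := hv
  refine ⟨C + C', max R R', ?_⟩
  filter_upwards [h, h'] with x hx hx' hR
  rw [add_mul]
  exact (norm_sub_le _ _).trans
    (add_le_add (hx ((le_max_left _ _).trans hR)) (hx' ((le_max_right _ _).trans hR)))

theorem DecaysAtInfinity.toC {u : V3 ℝ → V3 ℝ} (hu : DecaysAtInfinity u) :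
    DecaysAtInfinity fun x => toC (u x) := by
  obtain ⟨C, R, h⟩ := hu
  exact ⟨C, R, by simpa only [norm_toC] using h⟩

theorem DecaysAtInfinity.exists_ae_norm_le (hW : DecaysAtInfinity W) :
    ∃ D R₀ : ℝ, ∀ R, 0 < R → R₀ ≤ R → ∀ᵐ x, R ≤ ‖x‖ → ‖W x‖ ≤ D * R⁻¹ := by
  obtain ⟨D, R₀, hD⟩ := hW
  refine ⟨D, R₀, fun R hR hR₀ => ?_⟩
  filter_upwards [hD] with x hx hRx
  have hxpos : 0 < ‖x‖⁻¹ := inv_pos.2 (hR.trans_le hRx)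
  have hWx := hx (hR₀.trans hRx)
  have hD0 : 0 ≤ D := nonneg_of_mul_nonneg_left ((norm_nonneg _).trans hWx) hxpos
  exact hWx.trans (by gcongr)

-- The shell has volume `O(R³)`, on which `g² ‖W‖² = O(R⁻² R⁻²)`.
theorem DecaysAtInfinity.exists_integral_shell_le (hW : DecaysAtInfinity W) (G : ℝ) :
    ∃ K R₀ : ℝ, ∀ R, 0 < R → R₀ ≤ R → ∀ g : V3 ℝ → ℝ, (∀ x, 0 ≤ g x) →
      (∀ x, g x ≤ (Metric.closedBall (0 : V3 ℝ) (2 * R) \ Metric.ball 0 R).indicator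
        (fun _ => G * R⁻¹) x) → ∫ x, g x ^ 2 * ‖W x‖ ^ 2 ≤ K * R⁻¹ := by
  obtain ⟨D, R₀, hD⟩ := hW.exists_ae_norm_le
  refine ⟨8 * volume.real (Metric.ball (0 : V3 ℝ) 1) * (G ^ 2 * D ^ 2), R₀,
    fun R hR hR₀ g hg hgG => ?_⟩
  have hmeas : MeasurableSet (Metric.closedBall (0 : V3 ℝ) (2 * R)) := measurableSet_closedBall
  have hvol : volume.real (Metric.closedBall (0 : V3 ℝ) (2 * R)) =
      (2 * R) ^ 3 * volume.real (Metric.ball (0 : V3 ℝ) 1) := by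
    rw [Measure.addHaar_real_closedBall _ _ (by positivity)]
    simp
  have hbound : ∀ᵐ x, g x ^ 2 * ‖W x‖ ^ 2 ≤ (Metric.closedBall (0 : V3 ℝ) (2 * R)).indicator
      (fun _ => (G * R⁻¹) ^ 2 * (D * R⁻¹) ^ 2) x := by
    filter_upwards [hD R hR hR₀] with x hx
    have hgx := hgG x
    by_cases hshell : x ∈ Metric.closedBall (0 : V3 ℝ) (2 * R) \ Metric.ball 0 R
    · rw [Set.indicator_of_mem hshell] at hgx
      rw [Set.indicator_of_mem hshell.1]
      have hWx := hx (not_lt.1 fun h => hshell.2 (mem_ball_zero_iff.2 h))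
      have hgx0 := hg x
      gcongr
    · rw [Set.indicator_of_notMem hshell] at hgx
      rw [le_antisymm hgx (hg x), zero_pow two_ne_zero, zero_mul]
      exact Set.indicator_nonneg (fun _ _ => by positivity) x
  calc ∫ x, g x ^ 2 * ‖W x‖ ^ 2
      ≤ ∫ x, (Metric.closedBall (0 : V3 ℝ) (2 * R)).indicator
          (fun _ => (G * R⁻¹) ^ 2 * (D * R⁻¹) ^ 2) x :=
        integral_mono_of_nonneg (.of_forall fun x => by positivity)
          ((integrable_indicator_iff hmeas).2 (integrableOn_const measure_closedBall_lt_top.ne))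
          hbound
    _ = volume.real (Metric.closedBall (0 : V3 ℝ) (2 * R)) *
          ((G * R⁻¹) ^ 2 * (D * R⁻¹) ^ 2) := by
        rw [integral_indicator_const _ hmeas, smul_eq_mul]
    _ = _ := by
        rw [hvol]
        field_simp
        ring

theorem MemL2Loc.ae_eq_zero_of_integral_closedBall_nonpos (hu : MemL2Loc u)
    (h : ∀ n : ℕ, ∫ x in Metric.closedBall (0 : V3 ℝ) n, ‖u x‖ ^ 2 ≤ 0) :
    u =ᵐ[volume] 0 := by
  have hball (n : ℕ) : ∀ᵐ x, x ∈ Metric.closedBall (0 : V3 ℝ) n → u x = 0 := by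
    have hint := locallyIntegrable_iff.1 hu.locallyIntegrable_norm_sq _
      (isCompact_closedBall (0 : V3 ℝ) n)
    have hzero := (setIntegral_eq_zero_iff_of_nonneg_ae (.of_forall fun x => by positivity)
      hint).1 (le_antisymm (h n) (integral_nonneg fun x => by positivity))
    rw [Filter.EventuallyEq, ae_restrict_iff' measurableSet_closedBall] at hzero
    filter_upwards [hzero] with x hx hxn
    simpa using hx hxn
  filter_upwards [ae_all_iff.2 hball] with x hx
  obtain ⟨n, hn⟩ := exists_nat_ge ‖x‖
  exact hx n (mem_closedBall_zero_iff.2 hn)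

theorem IsUniformlyElliptic.exists_integral_closedBall_le {m : V3 ℝ → ℝ} {c C : ℝ}
    (hm : IsUniformlyElliptic m c C) (hW : MemHCurlLoc W) (hd : DecaysAtInfinity W)
    (h : ∀ χ : V3 ℝ → ℝ, ContDiff ℝ (⊤ : ℕ∞) χ → HasCompactSupport χ →
      RCLike.re (curlForm m (fun x => χ x • W x) W) = 0) :
    ∃ K R₀ : ℝ, ∀ R, 0 < R → R₀ ≤ R →
      ∫ x in Metric.closedBall (0 : V3 ℝ) R, ‖weakCurl W x‖ ^ 2 ≤ K * R⁻¹ := by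
  obtain ⟨G, hG⟩ := exists_cutoff (V3 ℝ)
  obtain ⟨K, R₀, hK⟩ := hd.exists_integral_shell_le G
  have hC : 0 ≤ C := hm.pos.le.trans ((hm.le_apply 0).trans (hm.apply_le 0))
  refine ⟨c⁻¹ * (64 * C * K), R₀, fun R hR hR₀ => ?_⟩
  obtain ⟨χ, hχ, hχc, hχ1, hχG⟩ := hG R hR
  have hχ2c : HasCompactSupport fun x => χ x ^ 2 := hχc.comp_left (g := (· ^ 2)) (by simp)
  have hint := hW.memL2Loc_weakCurl.integrable_mul_norm_sq (hχ.continuous.pow 2) hχ2c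
  calc ∫ x in Metric.closedBall (0 : V3 ℝ) R, ‖weakCurl W x‖ ^ 2
      = ∫ x in Metric.closedBall (0 : V3 ℝ) R, χ x ^ 2 * ‖weakCurl W x‖ ^ 2 :=
        setIntegral_congr_fun measurableSet_closedBall fun x hx => by simp [hχ1 x hx]
    _ ≤ ∫ x, χ x ^ 2 * ‖weakCurl W x‖ ^ 2 :=
        setIntegral_le_integral hint (.of_forall fun x => by positivity)
    _ ≤ c⁻¹ * (64 * C * ∫ x, ‖fderiv ℝ χ x‖ ^ 2 * ‖W x‖ ^ 2) :=
        (le_inv_mul_iff₀ hm.pos).2 (hm.caccioppoli hW hχ hχc (h _ (hχ.pow 2) hχ2c))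
    _ ≤ c⁻¹ * (64 * C * (K * R⁻¹)) := by
        have hcinv := inv_nonneg.2 hm.pos.le
        gcongr
        exact hK R hR hR₀ _ (fun x => norm_nonneg _) hχG
    _ = c⁻¹ * (64 * C * K) * R⁻¹ := by ring

theorem IsUniformlyElliptic.weakCurl_ae_eq_zero {m : V3 ℝ → ℝ} {c C : ℝ}
    (hm : IsUniformlyElliptic m c C) (hW : MemHCurlLoc W) (hd : DecaysAtInfinity W)
    (h : ∀ χ : V3 ℝ → ℝ, ContDiff ℝ (⊤ : ℕ∞) χ → HasCompactSupport χ →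
      RCLike.re (curlForm m (fun x => χ x • W x) W) = 0) : weakCurl W =ᵐ[volume] 0 := by
  obtain ⟨K, R₀, hK⟩ := hm.exists_integral_closedBall_le hW hd h
  refine hW.memL2Loc_weakCurl.ae_eq_zero_of_integral_closedBall_nonpos fun n => ?_
  have hlim : Filter.Tendsto (fun R : ℝ => K * R⁻¹) Filter.atTop (nhds 0) := by
    simpa using tendsto_inv_atTop_zero.const_mul K
  refine ge_of_tendsto hlim ?_
  filter_upwards [Filter.eventually_gt_atTop 0, Filter.eventually_ge_atTop R₀,
    Filter.eventually_ge_atTop (n : ℝ)] with R hR hR₀ hn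
  refine (setIntegral_mono_set ?_ (.of_forall fun x => by positivity)
    (Metric.closedBall_subset_closedBall hn).eventuallyLE).trans (hK R hR hR₀)
  exact locallyIntegrable_iff.1 hW.memL2Loc_weakCurl.locallyIntegrable_norm_sq _
    (isCompact_closedBall (0 : V3 ℝ) R)

end Decay

/-! ### Independence of the choice of solutions -/

/-- `W` is a weak solution of the homogeneous problem `∇ × m ∇ × W - i ν χ_B W = 0` on `ℝ³` with
`W = O(|ξ|⁻¹)`, the problem solved by differences of solutions of the transmission problems. -/
structure IsHomogeneousSolution (m : V3 ℝ → ℝ) (B : Set (V3 ℝ)) (ν : ℝ) (W : V3 ℝ → V3 𝕜) :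
    Prop where
  memHCurlLoc : MemHCurlLoc W
  weak_eq : ∀ ψ : V3 ℝ → V3 𝕜, MemHCurlLoc ψ → HasCompactSupport ψ →
    curlForm m ψ W = RCLike.I * (ν : 𝕜) * ∫ x in B, inner 𝕜 (ψ x) (W x)
  decay : DecaysAtInfinity W

section Homogeneous

variable {m : V3 ℝ → ℝ} {c C : ℝ} {B : Set (V3 ℝ)} {ν : ℝ}

theorem integral_inner_smul_self (μ : Measure (V3 ℝ)) (χ : V3 ℝ → ℝ) (W : V3 ℝ → V3 𝕜) :
    ∫ x, inner 𝕜 (χ x • W x) (W x) ∂μ = ((∫ x, χ x * ‖W x‖ ^ 2 ∂μ : ℝ) : 𝕜) := by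
  rw [← integral_ofReal]
  refine integral_congr_ae (.of_forall fun x => ?_)
  simp only [RCLike.real_smul_eq_coe_smul (K := 𝕜), inner_smul_left, RCLike.conj_ofReal,
    inner_self_eq_norm_sq_to_K, RCLike.ofReal_mul, RCLike.ofReal_pow]

theorem IsHomogeneousSolution.curlForm_smul_self {W : V3 ℝ → V3 𝕜}
    (h : IsHomogeneousSolution m B ν W) {χ : V3 ℝ → ℝ} (hχ : ContDiff ℝ (⊤ : ℕ∞) χ)
    (hχc : HasCompactSupport χ) :
    curlForm m (fun x => χ x • W x) W =
      RCLike.I * (ν : 𝕜) * ((∫ x in B, χ x * ‖W x‖ ^ 2 : ℝ) : 𝕜) := by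
  rw [h.weak_eq _ (h.memHCurlLoc.smul hχ) hχc.smul_right, integral_inner_smul_self]

theorem IsHomogeneousSolution.weakCurl_ae_eq_zero {W : V3 ℝ → V3 𝕜}
    (h : IsHomogeneousSolution m B ν W) (hm : IsUniformlyElliptic m c C) :
    weakCurl W =ᵐ[volume] 0 := by
  refine hm.weakCurl_ae_eq_zero h.memHCurlLoc h.decay fun χ hχ hχc => ?_
  rw [h.curlForm_smul_self hχ hχc, mul_assoc, ← RCLike.ofReal_mul]
  simp

theorem IsHomogeneousSolution.ae_restrict_eq_zero {W : V3 ℝ → V3 ℂ}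
    (h : IsHomogeneousSolution m B ν W) (hm : IsUniformlyElliptic m c C) (hν : ν ≠ 0) :
    ∀ᵐ x ∂volume.restrict B, W x = 0 := by
  have hloc : LocallyIntegrable (fun x => ‖W x‖ ^ 2) (volume.restrict B) :=
    fun x => (h.memHCurlLoc.memL2Loc.locallyIntegrable_norm_sq x).mono_measure
      Measure.restrict_le_self
  filter_upwards [ae_eq_zero_of_integral_contDiff_smul_eq_zero hloc fun χ hχ hχc => by
    have hzero := h.curlForm_smul_self hχ hχc
    rw [curlForm_eq_zero_of_weakCurl_ae_eq_zero (h.weakCurl_ae_eq_zero hm)] at hzero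
    simpa [hν] using hzero.symm] with x hx
  simpa using hx

end Homogeneous

/-- The total field `θ_i^{(0)} + θ_i^{(1)}` of the eddy current problem, as a complex field. -/
def totalField (θ0 : V3 ℝ → V3 ℝ) (θ1 : V3 ℝ → V3 ℂ) (ξ : V3 ℝ) : V3 ℂ := toC (θ0 ξ) + θ1 ξ

theorem tensorI_eq_integral_totalField (α : ℝ) (B : Set (V3 ℝ)) (ν : ℝ)
    (θ0 : Fin 3 → V3 ℝ → V3 ℝ) (θ1 : Fin 3 → V3 ℝ → V3 ℂ) (i j : Fin 3) :
    tensorI α B ν θ0 θ1 i j = (α : ℂ) ^ 3 / 4 *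
      (ν * ∫ ξ in B, inner ℂ (totalField (θ0 i) (θ1 i) ξ) (totalField (θ0 j) (θ1 j) ξ)) := by
  simp only [tensorI, thetaTilde, totalField, sub_add_cancel, integral_const_mul,
    add_comm (toC _)]

theorem continuous_eCross (i : Fin 3) : Continuous (eCross i) := by
  unfold eCross
  simp only [crossProduct, LinearMap.mk₂_apply]
  fun_prop

section Uniqueness

variable {B : Set (V3 ℝ)} {μr ν : ℝ} {i : Fin 3} {θ θ' : V3 ℝ → V3 ℝ} {θ1 θ1' : V3 ℝ → V3 ℂ}

theorem IsTheta0.curlForm_eq_zero (h : IsTheta0 B μr i θ) {ψ : V3 ℝ → V3 ℝ}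
    (hψ : MemHCurlLoc ψ) (hψc : HasCompactSupport ψ) : curlForm (muTilde B μr)⁻¹ ψ θ = 0 :=
  h.weak_eq ψ hψ hψc

theorem IsTheta0.isHomogeneousSolution_sub (hB : MeasurableSet B) (hμ : 0 < μr)
    (h : IsTheta0 B μr i θ) (h' : IsTheta0 B μr i θ') :
    IsHomogeneousSolution (muTilde B μr)⁻¹ B 0 (θ - θ') where
  memHCurlLoc := h.memHCurlLoc.sub h'.memHCurlLoc
  weak_eq ψ hψ hψc := by
    rw [(isUniformlyElliptic_inv_muTilde hB hμ).curlForm_sub_right hψ hψc h.memHCurlLoc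
      h'.memHCurlLoc, h.curlForm_eq_zero hψ hψc, h'.curlForm_eq_zero hψ hψc]
    simp
  decay := by
    convert h.decay.sub h'.decay using 1
    ext1 x
    simp

theorem IsTheta0.isWeakCurl_sub (hB : MeasurableSet B) (hμ : 0 < μr) (h : IsTheta0 B μr i θ)
    (h' : IsTheta0 B μr i θ') : IsWeakCurl (θ - θ') 0 :=
  have hsub := h.isHomogeneousSolution_sub hB hμ h'
  hsub.memHCurlLoc.isWeakCurl.congr_right
    (hsub.weakCurl_ae_eq_zero (isUniformlyElliptic_inv_muTilde hB hμ))

theorem IsTheta0.weakCurl_thetaTilde_eq (hB : MeasurableSet B) (hμ : 0 < μr)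
    {θ0 θ0' : Fin 3 → V3 ℝ → V3 ℝ} (h : IsTheta0 B μr i (θ0 i)) (h' : IsTheta0 B μr i (θ0' i)) :
    weakCurl (thetaTilde θ0 i) = weakCurl (thetaTilde θ0' i) := by
  have hcross := MemL2Loc.of_continuous (continuous_eCross i)
  refine weakCurl_eq_of_sub (h.memHCurlLoc.memL2Loc.sub hcross)
    (h'.memHCurlLoc.memL2Loc.sub hcross) ?_
  convert h.isWeakCurl_sub hB hμ h' using 1
  ext1 x
  simp [thetaTilde]

theorem IsTheta1.curlForm_eq (h : IsTheta1 B μr ν θ θ1) {ψ : V3 ℝ → V3 ℂ}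
    (hψ : MemHCurlLoc ψ) (hψc : HasCompactSupport ψ) :
    curlForm (muTilde B μr)⁻¹ ψ θ1 =
      Complex.I * (ν : ℂ) * ∫ ξ in B, inner ℂ (ψ ξ) (totalField θ θ1 ξ) :=
  sub_eq_zero.1 (h.weak_eq ψ hψ hψc)

theorem memL2Loc_totalField (hθ : MemL2Loc θ) (hθ1 : MemL2Loc θ1) : MemL2Loc (totalField θ θ1) :=
  hθ.toC.add hθ1

theorem isWeakCurl_totalField_sub_sub (h : IsWeakCurl (θ - θ') 0) :
    IsWeakCurl (totalField θ θ1 - totalField θ' θ1' - (θ1 - θ1')) 0 := by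
  convert h.toC using 1
  · ext1 x
    simp only [totalField, Pi.sub_apply, toC_sub]
    abel
  · exact funext fun _ => toC_zero.symm

theorem IsTheta1.weakCurl_totalField_sub (h : IsTheta1 B μr ν θ θ1) (h' : IsTheta1 B μr ν θ' θ1')
    (hθ : MemL2Loc θ) (hθ' : MemL2Loc θ') (hcurl : IsWeakCurl (θ - θ') 0) :
    weakCurl (totalField θ θ1 - totalField θ' θ1') = weakCurl (θ1 - θ1') :=
  weakCurl_eq_of_sub ((memL2Loc_totalField hθ h.memHCurlLoc.memL2Loc).sub
      (memL2Loc_totalField hθ' h'.memHCurlLoc.memL2Loc))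
    (h.memHCurlLoc.sub h'.memHCurlLoc).memL2Loc (isWeakCurl_totalField_sub_sub hcurl)

theorem IsTheta1.isHomogeneousSolution_totalField_sub (hB : MeasurableSet B) (hμ : 0 < μr)
    (h0 : IsTheta0 B μr i θ) (h0' : IsTheta0 B μr i θ') (h1 : IsTheta1 B μr ν θ θ1)
    (h1' : IsTheta1 B μr ν θ' θ1') :
    IsHomogeneousSolution (muTilde B μr)⁻¹ B ν (totalField θ θ1 - totalField θ' θ1') := by
  have hT := memL2Loc_totalField h0.memHCurlLoc.memL2Loc h1.memHCurlLoc.memL2Loc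
  have hT' := memL2Loc_totalField h0'.memHCurlLoc.memL2Loc h1'.memHCurlLoc.memL2Loc
  have hcurl := h0.isWeakCurl_sub hB hμ h0'
  refine ⟨(h1.memHCurlLoc.sub h1'.memHCurlLoc).of_sub (hT.sub hT')
    (isWeakCurl_totalField_sub_sub hcurl), fun ψ hψ hψc => ?_, ?_⟩
  · have hint {T : V3 ℝ → V3 ℂ} (hT : MemL2Loc T) :
        Integrable (fun x => inner ℂ (ψ x) (T x)) (volume.restrict B) :=
      (hψ.memL2Loc.integrable_inner hT hψc
        (.of_forall fun x => image_eq_zero_of_notMem_tsupport)).restrict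
    rw [curlForm, h1.weakCurl_totalField_sub h1' h0.memHCurlLoc.memL2Loc
      h0'.memHCurlLoc.memL2Loc hcurl, ← curlForm,
      (isUniformlyElliptic_inv_muTilde hB hμ).curlForm_sub_right hψ hψc h1.memHCurlLoc
        h1'.memHCurlLoc, h1.curlForm_eq hψ hψc, h1'.curlForm_eq hψ hψc, ← mul_sub,
      ← integral_sub (hint hT) (hint hT')]
    simp only [Pi.sub_apply, inner_sub_right]
    rfl
  · convert (h0.decay.sub h0'.decay).toC.sub (h1'.decay.sub h1.decay) using 1
    ext1 x
    simp only [totalField, Pi.sub_apply, sub_sub_sub_cancel_right, toC_sub]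
    abel

theorem IsTheta1.weakCurl_eq (hB : MeasurableSet B) (hμ : 0 < μr) (h0 : IsTheta0 B μr i θ)
    (h0' : IsTheta0 B μr i θ') (h1 : IsTheta1 B μr ν θ θ1) (h1' : IsTheta1 B μr ν θ' θ1') :
    weakCurl θ1 = weakCurl θ1' := by
  refine weakCurl_eq_of_weakCurl_sub_ae_eq_zero h1.memHCurlLoc h1'.memHCurlLoc ?_
  rw [← h1.weakCurl_totalField_sub h1' h0.memHCurlLoc.memL2Loc h0'.memHCurlLoc.memL2Loc
    (h0.isWeakCurl_sub hB hμ h0')]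
  exact (IsTheta1.isHomogeneousSolution_totalField_sub hB hμ h0 h0' h1 h1').weakCurl_ae_eq_zero
    (isUniformlyElliptic_inv_muTilde hB hμ)

theorem IsTheta1.totalField_ae_eq (hB : MeasurableSet B) (hμ : 0 < μr) (hν : ν ≠ 0)
    (h0 : IsTheta0 B μr i θ) (h0' : IsTheta0 B μr i θ') (h1 : IsTheta1 B μr ν θ θ1)
    (h1' : IsTheta1 B μr ν θ' θ1') :
    totalField θ θ1 =ᵐ[volume.restrict B] totalField θ' θ1' := by
  filter_upwards [(isHomogeneousSolution_totalField_sub hB hμ h0 h0' h1 h1').ae_restrict_eq_zero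
    (isUniformlyElliptic_inv_muTilde hB hμ) hν] with x hx
  exact sub_eq_zero.1 hx

end Uniqueness

theorem IsMPT.unique {B : Set (V3 ℝ)} (hB : MeasurableSet B) {α ω μr σ : ℝ} (hμ : 0 < μr)
    {M M' : Matrix (Fin 3) (Fin 3) ℂ} (h : IsMPT α B ω μr σ M) (h' : IsMPT α B ω μr σ M') :
    M = M' := by
  obtain ⟨θ0, θ1, h0, h1, hM⟩ := h
  obtain ⟨θ0', θ1', h0', h1', hM'⟩ := h'
  have hcurl0 i : weakCurl (thetaTilde θ0 i) = weakCurl (thetaTilde θ0' i) :=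
    IsTheta0.weakCurl_thetaTilde_eq hB hμ (h0 i) (h0' i)
  have hcurl1 i : weakCurl (θ1 i) = weakCurl (θ1' i) :=
    IsTheta1.weakCurl_eq hB hμ (h0 i) (h0' i) (h1 i) (h1' i)
  have hI i j : tensorI α B (nu α ω σ) θ0 θ1 i j = tensorI α B (nu α ω σ) θ0' θ1' i j := by
    obtain hν | hν := eq_or_ne (nu α ω σ) 0
    · simp [tensorI, hν]
    rw [tensorI_eq_integral_totalField, tensorI_eq_integral_totalField]
    congr 2
    refine integral_congr_ae ?_
    filter_upwards [IsTheta1.totalField_ae_eq hB hμ hν (h0 i) (h0' i) (h1 i) (h1' i),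
      IsTheta1.totalField_ae_eq hB hμ hν (h0 j) (h0' j) (h1 j) (h1' j)] with x hi hj
    rw [hi, hj]
  ext i j
  simp only [hM, hM', hI, tensorN0, tensorR, hcurl0, hcurl1]

/-! ### Dilations -/

/-- The dilation `ξ ↦ t u(ξ / t)` of a vector field, which carries fields for the object `B` to
fields for `t B`; the factor `t` is chosen so that `e_i × ξ` is invariant. -/
def dilate (t : ℝ) (u : V3 ℝ → V3 𝕜) (x : V3 ℝ) : V3 𝕜 := t • u (t⁻¹ • x)

section Dilation

variable {t : ℝ}

theorem dilate_smul (ht : t ≠ 0) (u : V3 ℝ → V3 𝕜) (x : V3 ℝ) :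
    dilate t u (t • x) = t • u x := by
  rw [dilate, inv_smul_smul₀ ht]

theorem dilate_dilate_inv (ht : t ≠ 0) (u : V3 ℝ → V3 𝕜) : dilate t (dilate t⁻¹ u) = u := by
  ext1 x
  simp [dilate, smul_smul, ht]

theorem dilate_inv_dilate (ht : t ≠ 0) (u : V3 ℝ → V3 𝕜) : dilate t⁻¹ (dilate t u) = u := by
  simpa only [inv_inv] using dilate_dilate_inv (inv_ne_zero ht) u

theorem dilate_sub (u v : V3 ℝ → V3 𝕜) : dilate t (u - v) = dilate t u - dilate t v :=
  funext fun _ => smul_sub _ _ _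

theorem eCross_smul (i : Fin 3) (c : ℝ) (x : V3 ℝ) : eCross i (c • x) = c • eCross i x := by
  simp [eCross]

theorem dilate_eCross (ht : t ≠ 0) (i : Fin 3) : dilate t (eCross i) = eCross i := by
  ext1 x
  rw [dilate, ← eCross_smul, smul_inv_smul₀ ht]

theorem dilate_sub_eCross (ht : t ≠ 0) (i : Fin 3) (u : V3 ℝ → V3 ℝ) :
    (dilate t fun ξ => u ξ - eCross i ξ) = fun ξ => dilate t u ξ - eCross i ξ := by
  have h := dilate_sub (t := t) u (eCross i)
  rwa [dilate_eCross ht] at h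

theorem thetaTilde_dilate (ht : t ≠ 0) (θ0 : Fin 3 → V3 ℝ → V3 ℝ) (i : Fin 3) :
    thetaTilde (fun j => dilate t (θ0 j)) i = dilate t (thetaTilde θ0 i) :=
  (dilate_sub_eCross ht i (θ0 i)).symm

theorem totalField_dilate (θ0 : V3 ℝ → V3 ℝ) (θ1 : V3 ℝ → V3 ℂ) :
    totalField (dilate t θ0) (dilate t θ1) = dilate t (totalField θ0 θ1) := by
  ext1 x
  simp only [totalField, dilate, toC_smul, smul_add]

theorem muTilde_smul_smul (ht : t ≠ 0) (B : Set (V3 ℝ)) (μr : ℝ) (x : V3 ℝ) :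
    muTilde (t • B) μr (t • x) = muTilde B μr x := by
  classical
  exact if_congr (Set.smul_mem_smul_set_iff₀ ht B x) rfl rfl

theorem smul_compl_frontier (ht : t ≠ 0) (B : Set (V3 ℝ)) :
    t • (frontier B)ᶜ = (frontier (t • B))ᶜ := by
  have h : t • frontier B = frontier (t • B) := (Homeomorph.smulOfNeZero t ht).image_frontier B
  rw [← h]
  exact Set.image_compl_eq (Homeomorph.smulOfNeZero t ht).bijective

theorem smul_compl_closure (ht : t ≠ 0) (B : Set (V3 ℝ)) :
    t • (closure B)ᶜ = (closure (t • B))ᶜ := by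
  have h : t • closure B = closure (t • B) := (Homeomorph.smulOfNeZero t ht).image_closure B
  rw [← h]
  exact Set.image_compl_eq (Homeomorph.smulOfNeZero t ht).bijective

theorem ae_comp_smul (ht : t ≠ 0) {p : V3 ℝ → Prop} (h : ∀ᵐ x, p x) : ∀ᵐ x, p (t • x) :=
  (Measure.quasiMeasurePreserving_smul volume ht).ae h

theorem integral_eq_smul_integral_comp_smul {F : Type*} [NormedAddCommGroup F] [NormedSpace ℝ F]
    (ht : 0 < t) (f : V3 ℝ → F) : ∫ x, f x = t ^ 3 • ∫ x, f (t • x) := by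
  rw [Measure.integral_comp_smul_of_nonneg _ _ _ (hR := ht.le), finrank_euclideanSpace_fin,
    smul_inv_smul₀ (pow_ne_zero 3 ht.ne')]

theorem setIntegral_smul_eq_smul_setIntegral_comp_smul {F : Type*} [NormedAddCommGroup F]
    [NormedSpace ℝ F] (ht : 0 < t) (B : Set (V3 ℝ)) (f : V3 ℝ → F) :
    ∫ x in t • B, f x = t ^ 3 • ∫ x in B, f (t • x) := by
  rw [Measure.setIntegral_comp_smul_of_pos _ _ _ ht, finrank_euclideanSpace_fin,
    smul_inv_smul₀ (pow_ne_zero 3 ht.ne')]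

theorem MemL2Loc.comp_smul {u : V3 ℝ → V3 𝕜} (hu : MemL2Loc u) (ht : t ≠ 0) :
    MemL2Loc fun x => u (t • x) := by
  intro K hK
  have hemb : MeasurableEmbedding fun x : V3 ℝ => t • x :=
    (Homeomorph.smulOfNeZero t ht).measurableEmbedding
  have hpre : (fun x : V3 ℝ => t • x) ⁻¹' (t • K) = K := by
    ext x
    simp [Set.smul_mem_smul_set_iff₀ ht]
  refine (hemb.memLp_map_measure_iff (g := u)).1 ?_
  rw [← hpre, ← hemb.restrict_map, Measure.map_addHaar_smul volume ht, Measure.restrict_smul]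
  exact (hu _ (hK.smul t)).smul_measure ENNReal.ofReal_ne_top

theorem MemL2Loc.dilate {u : V3 ℝ → V3 𝕜} (hu : MemL2Loc u) (ht : t ≠ 0) :
    MemL2Loc (dilate t u) :=
  (hu.comp_smul (inv_ne_zero ht)).smul continuous_const

theorem curl_comp_smul (c : ℝ) (φ : V3 ℝ → V3 ℝ) (x : V3 ℝ) :
    curl (fun y => φ (c • y)) x = c • curl φ (c • x) := by
  ext k
  simp [curl, fderiv_comp_smul, mul_sub]

theorem IsWeakCurl.dilate {u v : V3 ℝ → V3 𝕜} (h : IsWeakCurl u v) (ht : 0 < t) :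
    IsWeakCurl (dilate t u) fun x => v (t⁻¹ • x) := by
  intro φ hφ hc
  have htest := h (fun y => φ (t • y)) (hφ.comp (contDiff_const_smul t)) (hc.comp_smul ht.ne')
  rw [integral_eq_smul_integral_comp_smul ht,
    integral_eq_smul_integral_comp_smul ht fun x => ∑ k, φ x k • v (t⁻¹ • x) k]
  simp only [dilate_smul ht.ne', inv_smul_smul₀ ht.ne', curl_comp_smul, PiLp.smul_apply, smul_smul,
    smul_eq_mul, mul_comm t] at htest ⊢
  rw [htest]

theorem MemHCurlLoc.dilate {u : V3 ℝ → V3 𝕜} (hu : MemHCurlLoc u) (ht : 0 < t) :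
    MemHCurlLoc (dilate t u) :=
  ⟨hu.memL2Loc.dilate ht.ne', _, hu.memL2Loc_weakCurl.comp_smul (inv_ne_zero ht.ne'),
    hu.isWeakCurl.dilate ht⟩

theorem weakCurl_dilate (ht : 0 < t) (u : V3 ℝ → V3 𝕜) :
    ∀ᵐ x, weakCurl (dilate t u) (t • x) = weakCurl u x := by
  by_cases hex : ∃ v : V3 ℝ → V3 𝕜, MemL2Loc v ∧ IsWeakCurl u v
  · obtain ⟨v, hv, huv⟩ := hex
    filter_upwards [huv.weakCurl_ae_eq hv, ae_comp_smul ht.ne'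
      ((huv.dilate ht).weakCurl_ae_eq (hv.comp_smul (inv_ne_zero ht.ne')))] with x hx hx'
    rw [hx', hx, inv_smul_smul₀ ht.ne']
  · have hex' : ¬∃ v : V3 ℝ → V3 𝕜, MemL2Loc v ∧ IsWeakCurl (dilate t u) v := by
      rintro ⟨v, hv, huv⟩
      have hback := huv.dilate (inv_pos.2 ht)
      rw [dilate_inv_dilate ht.ne'] at hback
      exact hex ⟨_, hv.comp_smul (inv_ne_zero (inv_ne_zero ht.ne')), hback⟩
    simp [weakCurl, hex, hex']

theorem IsDivFreeOn.dilate {u : V3 ℝ → V3 𝕜} {U : Set (V3 ℝ)} (h : IsDivFreeOn u U)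
    (ht : 0 < t) : IsDivFreeOn (dilate t u) (t • U) := by
  intro φ hφ hc hU
  have hsupp : tsupport (fun y => φ (t • y)) ⊆ U := by
    have hpre : tsupport (fun y => φ (t • y)) = (fun y : V3 ℝ => t • y) ⁻¹' tsupport φ :=
      tsupport_comp_eq_preimage φ (Homeomorph.smulOfNeZero t ht.ne')
    rw [hpre]
    exact fun y hy => (Set.smul_mem_smul_set_iff₀ ht.ne' _ _).1 (hU hy)
  have htest := h (fun y => φ (t • y)) (hφ.comp (contDiff_const_smul t)) (hc.comp_smul ht.ne')
    hsupp
  rw [integral_eq_smul_integral_comp_smul ht]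
  simp only [dilate_smul ht.ne', fderiv_comp_smul, PiLp.smul_apply, smul_apply, smul_smul,
    smul_eq_mul, mul_comm t] at htest ⊢
  rw [htest, smul_zero]

theorem DecaysAtInfinity.dilate {u : V3 ℝ → V3 𝕜} (h : DecaysAtInfinity u) (ht : 0 < t) :
    DecaysAtInfinity (dilate t u) := by
  obtain ⟨C, R, h⟩ := h
  refine ⟨t * C * t, t * R, ?_⟩
  filter_upwards [ae_comp_smul (inv_ne_zero ht.ne') h] with x hx hR
  rw [norm_smul, norm_inv, Real.norm_of_nonneg ht.le] at hx
  rw [MPT.dilate, norm_smul, Real.norm_of_nonneg ht.le]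
  refine (mul_le_mul_of_nonneg_left (hx ((le_inv_mul_iff₀ ht).2 hR)) ht.le).trans_eq ?_
  rw [mul_inv, inv_inv]
  ring

theorem hasCompactSupport_dilate {u : V3 ℝ → V3 𝕜} (h : HasCompactSupport u) (ht : t ≠ 0) :
    HasCompactSupport (dilate t u) :=
  (h.comp_smul (inv_ne_zero ht)).comp_left (g := fun v => t • v) (smul_zero t)

theorem curlForm_inv_muTilde_dilate (ht : 0 < t) (B : Set (V3 ℝ)) (μr : ℝ) (u v : V3 ℝ → V3 𝕜) :
    curlForm (muTilde (t • B) μr)⁻¹ (dilate t u) (dilate t v) =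
      t ^ 3 • curlForm (muTilde B μr)⁻¹ u v := by
  unfold curlForm
  rw [integral_eq_smul_integral_comp_smul ht]
  congr 1
  refine integral_congr_ae ?_
  filter_upwards [weakCurl_dilate ht u, weakCurl_dilate ht v] with x hu hv
  rw [hu, hv, Pi.inv_apply, Pi.inv_apply, muTilde_smul_smul ht.ne']

theorem setIntegral_smul_inner_dilate (ht : 0 < t) (B : Set (V3 ℝ)) (u v : V3 ℝ → V3 ℂ) :
    ∫ x in t • B, inner ℂ (dilate t u x) (dilate t v x) =
      (t : ℂ) ^ 5 * ∫ x in B, inner ℂ (u x) (v x) := by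
  rw [setIntegral_smul_eq_smul_setIntegral_comp_smul ht]
  simp only [dilate_smul ht.ne', RCLike.real_smul_eq_coe_smul (K := ℂ), inner_smul_left,
    inner_smul_right, Complex.conj_ofReal, integral_const_mul, Complex.coe_algebraMap, smul_eq_mul]
  push_cast
  ring

/-! ### Scaling of the solutions and of the tensor -/

section Scaling

variable {B : Set (V3 ℝ)} {μr : ℝ}

theorem IsTheta0.dilate {i : Fin 3} {θ : V3 ℝ → V3 ℝ} (h : IsTheta0 B μr i θ) (ht : 0 < t) :
    IsTheta0 (t • B) μr i (dilate t θ) where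
  memHCurlLoc := h.memHCurlLoc.dilate ht
  weak_eq ψ hψ hψc := by
    have htest := h.curlForm_eq_zero (hψ.dilate (inv_pos.2 ht))
      (hasCompactSupport_dilate hψc (inv_ne_zero ht.ne'))
    have hform := curlForm_inv_muTilde_dilate ht B μr (MPT.dilate t⁻¹ ψ) θ
    rw [dilate_dilate_inv ht.ne', htest, smul_zero] at hform
    exact hform
  div_free := smul_compl_frontier ht.ne' B ▸ h.div_free.dilate ht
  decay := dilate_sub_eCross ht.ne' i θ ▸ h.decay.dilate ht

theorem IsTheta1.dilate {ν : ℝ} {θ0 : V3 ℝ → V3 ℝ} {θ : V3 ℝ → V3 ℂ}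
    (h : IsTheta1 B μr (ν * t ^ 2) θ0 θ) (ht : 0 < t) :
    IsTheta1 (t • B) μr ν (dilate t θ0) (dilate t θ) where
  memHCurlLoc := h.memHCurlLoc.dilate ht
  weak_eq ψ hψ hψc := by
    have htest := h.curlForm_eq (hψ.dilate (inv_pos.2 ht))
      (hasCompactSupport_dilate hψc (inv_ne_zero ht.ne'))
    have hform := curlForm_inv_muTilde_dilate ht B μr (MPT.dilate t⁻¹ ψ) θ
    have hmass := setIntegral_smul_inner_dilate ht B (MPT.dilate t⁻¹ ψ) (totalField θ0 θ)
    rw [dilate_dilate_inv ht.ne'] at hform hmass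
    rw [← totalField_dilate] at hmass
    refine sub_eq_zero.2 (hform.trans ?_)
    change _ = Complex.I * ν * ∫ ξ in t • B,
      inner ℂ (ψ ξ) (totalField (MPT.dilate t θ0) (MPT.dilate t θ) ξ)
    rw [htest, hmass, Complex.real_smul]
    push_cast
    ring
  div_free := smul_compl_closure ht.ne' B ▸ h.div_free.dilate ht
  decay := h.decay.dilate ht

theorem tensorN0_dilate (ht : 0 < t) (α : ℝ) (θ0 : Fin 3 → V3 ℝ → V3 ℝ) (i j : Fin 3) :
    tensorN0 α (t • B) μr (fun k => dilate t (θ0 k)) i j = tensorN0 (α * t) B μr θ0 i j := by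
  have henergy := curlForm_inv_muTilde_dilate ht B μr (thetaTilde θ0 i) (thetaTilde θ0 j)
  have hvolume := setIntegral_smul_eq_smul_setIntegral_comp_smul ht B fun _ => 1 - μr⁻¹
  simp only [curlForm, Pi.inv_apply, smul_eq_mul] at henergy hvolume
  simp only [tensorN0, thetaTilde_dilate ht.ne', henergy, hvolume]
  ring

theorem tensorR_dilate (ht : 0 < t) (α : ℝ) (θ1 : Fin 3 → V3 ℝ → V3 ℂ) (i j : Fin 3) :
    tensorR α (t • B) μr (fun k => dilate t (θ1 k)) i j = tensorR (α * t) B μr θ1 i j := by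
  have henergy := curlForm_inv_muTilde_dilate ht B μr (θ1 i) (θ1 j)
  simp only [curlForm, Pi.inv_apply, Complex.real_smul] at henergy
  simp only [tensorR, henergy]
  push_cast
  ring

theorem tensorI_dilate (ht : 0 < t) (α ν : ℝ) (θ0 : Fin 3 → V3 ℝ → V3 ℝ)
    (θ1 : Fin 3 → V3 ℝ → V3 ℂ) (i j : Fin 3) :
    tensorI α (t • B) ν (fun k => dilate t (θ0 k)) (fun k => dilate t (θ1 k)) i j =
      tensorI (α * t) B (ν * t ^ 2) θ0 θ1 i j := by
  simp only [tensorI_eq_integral_totalField, totalField_dilate, setIntegral_smul_inner_dilate ht]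
  push_cast
  ring

theorem IsMPT.smul {α ω σ : ℝ} {M : Matrix (Fin 3) (Fin 3) ℂ} (h : IsMPT (α * t) B ω μr σ M)
    (ht : 0 < t) : IsMPT α (t • B) ω μr σ M := by
  obtain ⟨θ0, θ1, h0, h1, hM⟩ := h
  have hν : nu (α * t) ω σ = nu α ω σ * t ^ 2 := by
    unfold nu
    ring
  rw [hν] at h1 hM
  refine ⟨fun i => MPT.dilate t (θ0 i), fun i => MPT.dilate t (θ1 i), fun i => (h0 i).dilate ht,
    fun i => (h1 i).dilate ht, fun i j => ?_⟩
  rw [hM, tensorN0_dilate ht, tensorR_dilate ht, tensorI_dilate ht]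

theorem isMPT_smul_iff (ht : 0 < t) {α ω σ : ℝ} {M : Matrix (Fin 3) (Fin 3) ℂ} :
    IsMPT α (t • B) ω μr σ M ↔ IsMPT (α * t) B ω μr σ M := by
  refine ⟨fun h => ?_, fun h => h.smul ht⟩
  rw [← mul_inv_cancel_right₀ ht.ne' α] at h
  simpa only [inv_smul_smul₀ ht.ne'] using h.smul (inv_pos.2 ht)

theorem isMPT_iff_of_smul_eq_smul {B' : Set (V3 ℝ)} {α α' ω σ : ℝ} (hα : 0 < α) (hα' : 0 < α')
    (h : α • B = α' • B') {M : Matrix (Fin 3) (Fin 3) ℂ} :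
    IsMPT α B ω μr σ M ↔ IsMPT α' B' ω μr σ M := by
  rw [← one_mul α, ← isMPT_smul_iff hα, h, isMPT_smul_iff hα', one_mul]

theorem tensorN0_mul (s α : ℝ) (θ0 : Fin 3 → V3 ℝ → V3 ℝ) (i j : Fin 3) :
    tensorN0 (s * α) B μr θ0 i j = s ^ 3 * tensorN0 α B μr θ0 i j := by
  unfold tensorN0
  ring

theorem tensorR_mul (s α : ℝ) (θ1 : Fin 3 → V3 ℝ → V3 ℂ) (i j : Fin 3) :
    tensorR (s * α) B μr θ1 i j = (s : ℂ) ^ 3 * tensorR α B μr θ1 i j := by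
  unfold tensorR
  push_cast
  ring

theorem tensorI_mul (s α ν : ℝ) (θ0 : Fin 3 → V3 ℝ → V3 ℝ) (θ1 : Fin 3 → V3 ℝ → V3 ℂ)
    (i j : Fin 3) : tensorI (s * α) B ν θ0 θ1 i j = (s : ℂ) ^ 3 * tensorI α B ν θ0 θ1 i j := by
  unfold tensorI
  push_cast
  ring

theorem isMPT_mul_iff {s : ℝ} (hs : s ≠ 0) {α ω σ : ℝ} {M : Matrix (Fin 3) (Fin 3) ℂ} :
    IsMPT (s * α) B ω μr σ ((s : ℂ) ^ 3 • M) ↔ IsMPT α B (s ^ 2 * ω) μr σ M := by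
  have hs3 : (s : ℂ) ^ 3 ≠ 0 := pow_ne_zero 3 (Complex.ofReal_ne_zero.2 hs)
  have hν : nu (s * α) ω σ = nu α (s ^ 2 * ω) σ := by
    unfold nu
    ring
  unfold IsMPT
  rw [hν]
  refine exists₂_congr fun θ0 θ1 => and_congr_right' (and_congr_right' ?_)
  refine forall₂_congr fun i j => ?_
  rw [tensorN0_mul, tensorR_mul, tensorI_mul, Complex.ofReal_mul, Complex.ofReal_pow,
    mul_left_comm, ← mul_add, ← mul_add, Matrix.smul_apply, smul_eq_mul, mul_right_inj' hs3]

end Scaling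

end Dilation

end MPT

end

-- For unbounded `B` an integral in `tensorN0` or `tensorI` may diverge; it then counts as `0`.
theorem mainTheorem3_general (B B' : Set (MPT.V3 ℝ)) (hB : MeasurableSet B)
    (α α' s : ℝ) (hα : 0 < α) (hα' : 0 < α') (hs : 0 < s)
    (hB' : α' • B' = (s * α) • B)
    (μr : ℝ) (hμr : 0 < μr) (ω σ : ℝ) :
    (∀ M M' : Matrix (Fin 3) (Fin 3) ℂ,
      MPT.IsMPT α B (s ^ 2 * ω) μr σ M → MPT.IsMPT α' B' ω μr σ M' →
        ∀ i j, M' i j = (s : ℂ) ^ 3 * M i j) ∧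
    (∀ M : Matrix (Fin 3) (Fin 3) ℂ,
      MPT.IsMPT α B (s ^ 2 * ω) μr σ M ↔ MPT.IsMPT α' B' ω μr σ ((s : ℂ) ^ 3 • M)) := by
  have presentation (N : Matrix (Fin 3) (Fin 3) ℂ) :
      MPT.IsMPT α' B' ω μr σ N ↔ MPT.IsMPT (s * α) B ω μr σ N :=
    MPT.isMPT_iff_of_smul_eq_smul hα' (mul_pos hs hα) hB'
  refine ⟨fun M M' hM hM' i j => ?_, fun M => ?_⟩
  · rw [((presentation M').1 hM').unique hB hμr ((MPT.isMPT_mul_iff hs.ne').2 hM),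
      Matrix.smul_apply, smul_eq_mul]
  · rw [presentation, MPT.isMPT_mul_iff hs.ne']

/-- Object-size scaling of the magnetic polarizability tensor. The object `sαB` may be presented in
any way as `α' B'`: with `α' = s α`, `B' = B`, with `α' = α`, `B' = s B`, or otherwise. Whatever
solutions of the transmission problems the two tensors are computed from, the tensor of `sαB` at
frequency `ω` is `s³` times that of `αB` at frequency `s² ω`, and each exists if the other does. -/
theorem mainTheorem3 (B B' : Set (MPT.V3 ℝ)) (hBo : IsOpen B) (hBb : Bornology.IsBounded B)
    (α α' s : ℝ) (hα : 0 < α) (hα' : 0 < α') (hs : 0 < s)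
    (hB' : α' • B' = (s * α) • B)
    (μr : ℝ) (hμr : 0 < μr) (ω σ : ℝ) :
    (∀ M M' : Matrix (Fin 3) (Fin 3) ℂ,
      MPT.IsMPT α B (s ^ 2 * ω) μr σ M → MPT.IsMPT α' B' ω μr σ M' →
        ∀ i j, M' i j = (s : ℂ) ^ 3 * M i j) ∧
    (∀ M : Matrix (Fin 3) (Fin 3) ℂ,
      MPT.IsMPT α B (s ^ 2 * ω) μr σ M ↔ MPT.IsMPT α' B' ω μr σ ((s : ℂ) ^ 3 • M)) :=
  mainTheorem3_general B B' hBo.measurableSet α α' s hα hα' hs hB' μr hμr ω σ
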